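/- Let $d\ge 1$. A block is a set $R=\prod_{i=1}^d[a_i,b_i]\subset\mathbb R^d$ with $a_i<b_i$ for all $i$; $|R|$ is its volume and $\operatorname{diam}(R)$ its Euclidean diameter. Let $\mathbb I=[-\frac12,\frac12]$ and $V=C^0(\mathbb I^d)$ with the uniform norm, and let $I:V\to V$ be a bounded linear operator with $I\circ I=I$ and image $V_I$. For a block $R$ let $\phi(x)=x_0+Dx$ ($D$ diagonal with positive entries) be the map with $\phi(\mathbb I^d)=R$, and for $f\in C^0(R)$ put $I_Rf:=I(f\circ\phi)\circ\phi^{-1}$. A block partition $\mathcal R$ of a block $R_0$ is a finite collection of blocks with union $R_0$ whose pairwise intersections have zero Lebesgue measure; for $f\in C^0(R_0)$, $I_{\mathcal R}f$ denotes the (almost everywhere defined) function that coincides with $I_Rf$ on the interior of each $R\in\mathcal R$. A sequence $(\mathcal R_N)_{N\ge1}$ of block partitions of $R_0$ is admissible if $\#(\mathcal R_N)\le N$ for all $N\ge1$ and $\sup_{N\ge1}\bigl(N^{1/d}\sup_{R\in\mathcal R_N}\operatorname{diam}(R)\bigr)<\infty$. For a multi-index $\alpha\in\mathbb Z_+^d$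 let $|\alpha|=\sum_i\alpha_i$ and $\alpha!=\prod_i\alpha_i!$. Let $P_k=\operatorname{span}\{X^\alpha:|\alpha|\le k\}$ and $P_k^*=\operatorname{span}\{X^\alpha:\max_i\alpha_i\le k,\ |\alpha|\le k+1\}$. Assume that there is a largest integer $k\ge0$ with $P_k\subset V_I$ (polynomials being restricted to $\mathbb I^d$), and let $m=k+1$. Fix $1\le p\le\infty$ and define $\tau\in(0,\infty)$ by $\frac1\tau=\frac md+\frac1p$. For a homogeneous polynomial $\pi$ of degree $m$ put $K_I(\pi):=\inf_{|R|=1}\|\pi-I_R\pi\|_{L_p(R)}$, the infimum being over all blocks $R$ of unit volume. For $f\in C^m(R_0)$ and $x\in R_0$, $\frac{d^mf(x)}{m!}$ is identified with the homogeneous polynomial $\sum_{|\alpha|=m}\frac{\partial^mf}{\partial x^\alpha}(x)\frac{X^\alpha}{\alpha!}$. Consider the following hypotheses on $I$: - $H_\pm$: $I(f\circ D)=I(f)\circ D$ for all $f\in V$ and all diagonal matrices $D$ with entries $\pm1$; - $H_\sigma$: $I(f\circ M)=I(f)\circ M$ for all $f\in V$ and all permutation matrices $M$; - $H_*$: $P_k^*\subset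 V_I$; - $H_{**}$: if $\sum_i\lambda_iX_i^m\in V_I$ with $\lambda_i\in\mathbb R$, then $\lambda_1=\dots=\lambda_d=0$. **Theorem.** Suppose that either $m$ is odd and $H_\pm$, $H_\sigma$, $H_*$ hold, or $m$ is even and $H_\sigma$, $H_*$, $H_{**}$ hold. Let $R_0$ be a block and let $f\in C^m(R_0)$ be such that $K_I\bigl(\frac{d^mf(x)}{m!}\bigr)>0$ for every $x\in R_0$. Then there is an admissible sequence $(\mathcal R_N)_{N\ge1}$ of block partitions of $R_0$ such that $$\limsup_{N\to\infty}N^{\frac md}\,\|f-I_{\mathcal R_N}f\|_{L_p(R_0)}\le\Bigl\|K_I\Bigl(\frac{d^mf}{m!}\Bigr)\Bigr\|_{L_\tau(R_0)}.$$ -/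

import Mathlib

open MeasureTheory Filter
open scoped ENNReal

namespace BlockInterp

noncomputable section

/-- A block `∏ᵢ [aᵢ, bᵢ]` in `ℝ^d`, with `aᵢ < bᵢ` for all `i`. -/
structure Block (d : ℕ) where
  lo : Fin d → ℝ
  hi : Fin d → ℝ
  lt : ∀ i, lo i < hi i

/-- The canonical block `[-1/2, 1/2]^d`. -/
def cube (d : ℕ) : Set (Fin d → ℝ) := Set.Icc (fun _ => -(1 / 2)) (fun _ => 1 / 2)

instance cubeCompact (d : ℕ) : CompactSpace (cube d) :=
  isCompact_iff_compactSpace.mp isCompact_Icc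

namespace Block

variable {d : ℕ}

/-- The set of points of a block. -/
def toSet (R : Block d) : Set (Fin d → ℝ) := Set.Icc R.lo R.hi

/-- The Euclidean diameter of a block, that is, the length of its diagonal. -/
def diam (R : Block d) : ℝ := Real.sqrt (∑ i, (R.hi i - R.lo i) ^ 2)

/-- The map `t ↦ x₀ + D t` (`D` diagonal with positive entries) that sends the canonical block
onto `R`. -/
def chart (R : Block d) (t : Fin d → ℝ) : Fin d → ℝ :=
  fun i => (R.lo i + R.hi i) / 2 + (R.hi i - R.lo i) * t i

/-- The inverse of `R.chart`. -/
def chartInv (R : Block d) (x : Fin d → ℝ) : Fin d → ℝ :=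
  fun i => (x i - (R.lo i + R.hi i) / 2) / (R.hi i - R.lo i)

end Block

/-- The space `V` of continuous functions on the canonical block, with the uniform norm. -/
abbrev V (d : ℕ) : Type := C(cube d, ℝ)

variable {d : ℕ}

open Classical in
/-- The operator `I` transported to the block `R`: `I_R f = I (f ∘ φ) ∘ φ⁻¹`, with `φ = R.chart`.
It is meant for functions `f` that are continuous on `R`, and its values matter on `R` only:
`ContinuousMap.mkD` bundles the function `f ∘ φ`, which is then continuous on the canonical block,
and its default value `0`, like the value `0` outside `R`, is never relevant. -/
def interpBlock (I : V d →L[ℝ] V d) (R : Block d) (f : (Fin d → ℝ) → ℝ) (x : Fin d → ℝ) : ℝ :=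
  if h : R.chartInv x ∈ cube d then
    I (ContinuousMap.mkD (fun t : cube d => f (R.chart t)) 0) ⟨R.chartInv x, h⟩
  else 0

/-- A block partition of `R₀`: a finite collection of blocks whose union is `R₀` and whose pairwise
intersections have zero Lebesgue measure. -/
structure IsBlockPartition (R₀ : Block d) (P : Finset (Block d)) : Prop where
  union_eq : (⋃ R ∈ P, R.toSet) = R₀.toSet
  null_inter : ∀ R ∈ P, ∀ R' ∈ P, R ≠ R' → volume (R.toSet ∩ R'.toSet) = 0

/-- The piecewise interpolant on a block partition: the function which coincides with `I_R f` on the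
interior of each block `R` of `P` (these interiors are pairwise disjoint), and is `0` on the null
set that remains. -/
def interpPartition (I : V d →L[ℝ] V d) (P : Finset (Block d)) (f : (Fin d → ℝ) → ℝ) :
    (Fin d → ℝ) → ℝ :=
  fun x => ∑ R ∈ P, (interior R.toSet).indicator (interpBlock I R f) x

/-- Admissible sequences of block partitions of `R₀` (the term of index `0` is irrelevant). -/
structure IsAdmissible (R₀ : Block d) (P : ℕ → Finset (Block d)) : Prop where
  partition : ∀ N, 1 ≤ N → IsBlockPartition R₀ (P N)
  card_le : ∀ N, 1 ≤ N → (P N).card ≤ N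
  diam_le : ∃ C : ℝ, ∀ N, 1 ≤ N → ∀ R ∈ P N, (N : ℝ) ^ (1 / (d : ℝ)) * R.diam ≤ C

/-- A polynomial, seen as an element of `V`. -/
def polyV (q : MvPolynomial (Fin d) ℝ) : V d where
  toFun t := MvPolynomial.eval (t : Fin d → ℝ) q
  continuous_toFun := (MvPolynomial.continuous_eval q).comp continuous_subtype_val

/-- The space `P_k`, spanned by the monomials `X^α` with `|α| ≤ k`. -/
def polyP (d k : ℕ) : Submodule ℝ (MvPolynomial (Fin d) ℝ) :=
  Submodule.span ℝ {q | ∃ α : Fin d →₀ ℕ, ∑ i, α i ≤ k ∧ q = MvPolynomial.monomial α 1}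

/-- The space `P_k^*`, spanned by the monomials `X^α` with `max α ≤ k` and `|α| ≤ k + 1`. -/
def polyPStar (d k : ℕ) : Submodule ℝ (MvPolynomial (Fin d) ℝ) :=
  Submodule.span ℝ {q | ∃ α : Fin d →₀ ℕ,
    (∀ i, α i ≤ k) ∧ ∑ i, α i ≤ k + 1 ∧ q = MvPolynomial.monomial α 1}

/-- The image `V_I` of the operator `I`. -/
def imageV (I : V d →L[ℝ] V d) : Set (V d) := Set.range I

/-- `k` is the largest integer `k' ≥ 0` such that `P_{k'} ⊆ V_I`. -/
def IsReproductionDegree (I : V d →L[ℝ] V d) (k : ℕ) : Prop :=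
  IsGreatest {k' : ℕ | ∀ q ∈ polyP d k', polyV q ∈ imageV I} k

/-- The action on the canonical block of the diagonal matrix with diagonal entries `ε i = ±1`. -/
def signMap (ε : Fin d → ℤˣ) : C(cube d, cube d) where
  toFun t := ⟨fun i => ((ε i : ℤ) : ℝ) * (t : Fin d → ℝ) i, by
    obtain ⟨h1, h2⟩ := t.2
    refine ⟨fun i => ?_, fun i => ?_⟩ <;>
    · have a := h1 i
      have b := h2 i
      rcases Int.units_eq_one_or (ε i) with h | h <;> simp [h] at a b ⊢ <;> linarith⟩
  continuous_toFun := by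
    refine Continuous.subtype_mk (continuous_pi fun i => ?_) _
    have h : Continuous fun t : cube d => (t : Fin d → ℝ) i :=
      (continuous_apply i).comp continuous_subtype_val
    exact h.const_mul _

/-- The action on the canonical block of the permutation matrix `M_{ij} = δ_{i σ(j)}`. -/
def permMap (σ : Equiv.Perm (Fin d)) : C(cube d, cube d) where
  toFun t := ⟨fun i => (t : Fin d → ℝ) (σ.symm i),
    ⟨fun i => t.2.1 (σ.symm i), fun i => t.2.2 (σ.symm i)⟩⟩
  continuous_toFun := by
    refine Continuous.subtype_mk (continuous_pi fun i => ?_) _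
    exact (continuous_apply (σ.symm i)).comp continuous_subtype_val

/-- The hypothesis `H_±`: `I` commutes with the sign changes of coordinates. -/
def HSign (I : V d →L[ℝ] V d) : Prop :=
  ∀ (ε : Fin d → ℤˣ) (f : V d), I (f.comp (signMap ε)) = (I f).comp (signMap ε)

/-- The hypothesis `H_σ`: `I` commutes with the permutations of coordinates. -/
def HPerm (I : V d →L[ℝ] V d) : Prop :=
  ∀ (σ : Equiv.Perm (Fin d)) (f : V d), I (f.comp (permMap σ)) = (I f).comp (permMap σ)

/-- The hypothesis `H_*`: `P_k^* ⊆ V_I`. -/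
def HStar (I : V d →L[ℝ] V d) (k : ℕ) : Prop :=
  ∀ q ∈ polyPStar d k, polyV q ∈ imageV I

/-- The hypothesis `H_**`: if `∑ᵢ λᵢ Xᵢ^m ∈ V_I` then all `λᵢ` vanish. -/
def HStarStar (I : V d →L[ℝ] V d) (m : ℕ) : Prop :=
  ∀ c : Fin d → ℝ,
    polyV (∑ i, MvPolynomial.C (c i) * MvPolynomial.X i ^ m) ∈ imageV I → c = 0

/-- The error function `K_I`, relative to the exponent `p`: the infimum of `‖π - I_R π‖_{L_p(R)}`
over the blocks `R` of unit volume. It is used for homogeneous polynomials of degree `m`.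
The norms involved are finite, so the infimum is the usual one of real numbers. -/
def errorFun (I : V d →L[ℝ] V d) (p : ℝ≥0∞) (π : MvPolynomial (Fin d) ℝ) : ℝ≥0∞ :=
  ⨅ (R : Block d) (_ : volume R.toSet = 1),
    eLpNorm (fun x => MvPolynomial.eval x π -
      interpBlock I R (fun y => MvPolynomial.eval y π) x) p (volume.restrict R.toSet)

/-- The list of coordinate directions in which `i` occurs `α i` times. -/
def dirs (α : Fin d →₀ ℕ) : List (Fin d) :=
  (List.finRange d).flatMap fun i => List.replicate (α i) i

/-- The partial derivative `∂^α f (x)` of order `|α|`, for `f` defined on `S`: the differential of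
order `|α|` of `f` within `S`, evaluated at the vectors `e_i`, each taken `α i` times. -/
def partialDeriv (f : (Fin d → ℝ) → ℝ) (S : Set (Fin d → ℝ)) (α : Fin d →₀ ℕ)
    (x : Fin d → ℝ) : ℝ :=
  iteratedFDerivWithin ℝ (dirs α).length f S x fun l => Pi.single ((dirs α).get l) 1

/-- The homogeneous polynomial `∑_{|α| = m} ∂^α f (x) X^α / α!` identified with `d^m f(x) / m!`. -/
def taylorHom (m : ℕ) (f : (Fin d → ℝ) → ℝ) (S : Set (Fin d → ℝ)) (x : Fin d → ℝ) :
    MvPolynomial (Fin d) ℝ :=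
  ∑ α ∈ Finset.finsuppAntidiag Finset.univ m,
    MvPolynomial.monomial α (partialDeriv f S α x / ∏ i, ((α i).factorial : ℝ))

/-- The exponent `τ` with `1 / τ = m / d + 1 / p` (where `1 / ∞ = 0`). -/
def tau (m d : ℕ) (p : ℝ≥0∞) : ℝ≥0∞ := ((m : ℝ≥0∞) / (d : ℝ≥0∞) + p⁻¹)⁻¹

end

end BlockInterp

/-!
Write `m = k + 1`. By `H_*`, the operator `I` reproduces `P_k` and all monomials of degree `m`
other than the pure powers `X_i ^ m`. Hence the error committed on a block with side lengths
`D_i`, for a polynomial of degree `m` whose coefficients on the `X_i ^ m` are `lam_i`, is that of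
`∑ i, lam_i D_i ^ m X_i ^ m` on the canonical block. It is measured, up to the factor
`|R| ^ (1 / p)`, by `‖L (lam_i D_i ^ m)‖` for a linear map `L : ℝ^d → L_p` (`pureErrLp`,
`eLpNorm_taylorHom_error`), so that `K_I` is the infimum of `‖L (lam_i D_i ^ m)‖` over the `D` of
product `1`.

If `lam_i = 0`, or if `X_i ^ m` is reproduced, stretching blocks in the direction `i` shows that
`K_I` vanishes (`errorFun_eq_zero`). As `K_I (d^m f / m!) > 0`, all the `lam_i` are therefore
nonzero, and `L` is injective, by sign changes of the coordinates if `m` is odd and by `H_**`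
otherwise. So `‖L (lam_i D_i ^ m)‖` tends to infinity with `D`, and an optimal `D` exists.
Rescaling the coordinates reduces the optimization to the case `lam_i = ± 1`; since the signs of
the `lam_i` do not change on the connected set `R₀`, the function `K = K_I (d^m f / m!)` is a
constant times the geometric mean of the `|lam_i|`, and the optimal shapes form a continuous field
`a` on `R₀` (`exists_continuous_optimal_sides`).

The side lengths `s = a * K ^ (-τ / d)`, multiplied by a small scale `h`, equidistribute the local
errors: each is about `h ^ (m + d / p)`. Cut `R₀` into small cells, and each cell into blocks of
sides close to, and at most, `h * s z`, for a point `z` of the cell where the density `K ^ τ` of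
blocks is smallest. There are then about `h ^ (-d) * ∫ K ^ τ` blocks, and the global error
follows; Taylor's formula controls the difference between `f` and its Taylor polynomials of degree
`m` (`eLpNorm_interp_error_le`, `eventually_exists_tiling`). The diameters of the blocks are
bounded by a multiple of `h`, uniformly in the tolerance `ε`, because the field `s` is bounded.
Partitions that are nearly the best ones under this bound on the diameters are then good for every
`ε` (`exists_admissible`).
-/

namespace BlockInterp

variable {d : ℕ}

/-! ### Blocks, subdivisions and partitions -/

namespace Block

/-- The side lengths of a block. -/
def side (R : Block d) (i : Fin d) : ℝ := R.hi i - R.lo i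

lemma side_pos (R : Block d) (i : Fin d) : 0 < R.side i := sub_pos.2 (R.lt i)

lemma prod_side_pos (R : Block d) : 0 < ∏ i, R.side i := Finset.prod_pos fun i _ => R.side_pos i

lemma volume_toSet (R : Block d) : volume R.toSet = ENNReal.ofReal (∏ i, R.side i) := by
  rw [toSet, Real.volume_Icc_pi, ENNReal.ofReal_prod_of_nonneg fun i _ => (R.side_pos i).le]
  rfl

lemma measurableSet_toSet (R : Block d) : MeasurableSet R.toSet := measurableSet_Icc

lemma isCompact_toSet (R : Block d) : IsCompact R.toSet := isCompact_Icc

lemma convex_toSet (R : Block d) : Convex ℝ R.toSet := convex_Icc _ _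

lemma lo_mem (R : Block d) : R.lo ∈ R.toSet := Set.left_mem_Icc.2 fun i => (R.lt i).le

lemma interior_toSet (R : Block d) : 
    interior R.toSet = Set.univ.pi fun i => Set.Ioo (R.lo i) (R.hi i) := by
  rw [toSet, ← Set.pi_univ_Icc, interior_pi_set Set.finite_univ]
  simp

lemma uniqueDiffOn_toSet (R : Block d) : UniqueDiffOn ℝ R.toSet := by
  refine uniqueDiffOn_convex R.convex_toSet ⟨fun i => (R.lo i + R.hi i) / 2, ?_⟩
  rw [interior_toSet]
  intro i _
  have := R.lt i
  constructor <;> simp only <;> linarith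

/-- The boundary of a block is negligible. -/
lemma ae_mem_interior (R : Block d) : ∀ᵐ x ∂volume.restrict R.toSet, x ∈ interior R.toSet := by
  have h : volume (frontier R.toSet) = 0 := R.convex_toSet.addHaar_frontier volume
  rw [ae_restrict_iff' R.measurableSet_toSet]
  filter_upwards [measure_eq_zero_iff_ae_notMem.1 h] with x hx hxR
  by_contra hxi
  exact hx ⟨subset_closure hxR, hxi⟩

lemma diam_le (R : Block d) {B : ℝ} (h : ∀ i, R.side i ≤ B) : R.diam ≤ Real.sqrt d * B := by
  rcases Nat.eq_zero_or_pos d with rfl | hd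
  · simp [diam]
  have hB : 0 ≤ B := (R.side_pos ⟨0, hd⟩).le.trans (h _)
  rw [diam]
  refine Real.sqrt_le_iff.2 ⟨by positivity, ?_⟩
  rw [mul_pow, Real.sq_sqrt (Nat.cast_nonneg d)]
  calc ∑ i, (R.hi i - R.lo i) ^ 2 ≤ ∑ _i : Fin d, B ^ 2 :=
        Finset.sum_le_sum fun i _ => pow_le_pow_left₀ (R.side_pos i).le (h i) 2
    _ = d * B ^ 2 := by simp

/-- The piece of index `j` when side `i` of `Q` is cut into `n i` equal parts. -/
noncomputable def piece (Q : Block d) (n : Fin d → ℕ) (j : ∀ i, Fin (n i)) : Block d where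
  lo i := Q.lo i + Q.side i / n i * (j i : ℕ)
  hi i := Q.lo i + Q.side i / n i * ((j i : ℕ) + 1)
  lt i := by
    have h : 0 < Q.side i / n i := div_pos (Q.side_pos i) (Nat.cast_pos.2 (j i).pos)
    nlinarith

lemma side_piece (Q : Block d) (n : Fin d → ℕ) (j : ∀ i, Fin (n i)) (i : Fin d) :
    (Q.piece n j).side i = Q.side i / n i := by
  simp only [side, piece]
  ring

open Classical in
/-- The subdivision of `Q` into `∏ n i` congruent blocks, side `i` being cut into `n i` parts. -/
noncomputable def subdivide (Q : Block d) (n : Fin d → ℕ) : Finset (Block d) :=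
  Finset.univ.image (Q.piece n)

lemma card_subdivide_le (Q : Block d) (n : Fin d → ℕ) : (Q.subdivide n).card ≤ ∏ i, n i := by
  classical
  refine Finset.card_image_le.trans ?_
  simp

lemma side_of_mem_subdivide {Q R : Block d} {n : Fin d → ℕ} (hR : R ∈ Q.subdivide n) (i : Fin d) :
    R.side i = Q.side i / n i := by
  classical
  obtain ⟨j, -, rfl⟩ := Finset.mem_image.1 hR
  exact side_piece Q n j i

lemma exists_nat_subinterval {a δ x : ℝ} {n : ℕ} (hn : 0 < n) (h1 : a ≤ x) (h2 : x ≤ a + δ * n) :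
    ∃ j < n, a + δ * j ≤ x ∧ x ≤ a + δ * (j + 1) := by
  induction n with
  | zero => omega
  | succ n ih =>
    rcases Nat.eq_zero_or_pos n with rfl | hn'
    · exact ⟨0, by omega, by simpa using h1, by simpa using h2⟩
    rcases le_total x (a + δ * n) with h | h
    · obtain ⟨j, hj, h3⟩ := ih hn' h
      exact ⟨j, by omega, h3⟩
    · exact ⟨n, by omega, h, by simpa using h2⟩

lemma isBlockPartition_subdivide (Q : Block d) {n : Fin d → ℕ} (hn : ∀ i, 0 < n i) :
    IsBlockPartition Q (Q.subdivide n) := by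
  classical
  have hpos : ∀ i, 0 < Q.side i / n i := fun i =>
    div_pos (Q.side_pos i) (Nat.cast_pos.2 (hn i))
  have hmul : ∀ i, Q.side i / n i * n i = Q.side i := fun i =>
    div_mul_cancel₀ _ (Nat.cast_ne_zero.2 (hn i).ne')
  refine ⟨Set.Subset.antisymm ?_ ?_, ?_⟩
  · refine Set.iUnion₂_subset fun R hR => ?_
    obtain ⟨j, -, rfl⟩ := Finset.mem_image.1 hR
    refine Set.Icc_subset_Icc (fun i => ?_) (fun i => ?_)
    · have := hpos i
      simp only [piece]
      nlinarith [(Nat.cast_nonneg (j i : ℕ) : (0 : ℝ) ≤ _)]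
    · have h1 : ((j i : ℕ) : ℝ) + 1 ≤ n i := by exact_mod_cast (j i).2
      have h2 := mul_le_mul_of_nonneg_left h1 (hpos i).le
      rw [hmul] at h2
      simp only [piece]
      have : Q.hi i = Q.lo i + Q.side i := by simp [side]
      linarith
  · intro x hx
    have key : ∀ i, ∃ j < n i, Q.lo i + Q.side i / n i * j ≤ x i ∧
        x i ≤ Q.lo i + Q.side i / n i * (j + 1) := fun i => by
      refine exists_nat_subinterval (hn i) (hx.1 i) ?_
      rw [hmul]
      have := hx.2 i
      simp only [side]
      linarith
    choose j hj h1 h2 using key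
    simp only [Set.mem_iUnion]
    exact ⟨Q.piece n fun i => ⟨j i, hj i⟩, Finset.mem_image_of_mem _ (Finset.mem_univ _), h1, h2⟩
  · intro R hR R' hR' hne
    obtain ⟨j, -, rfl⟩ := Finset.mem_image.1 hR
    obtain ⟨j', -, rfl⟩ := Finset.mem_image.1 hR'
    have hjj : j ≠ j' := fun h => hne (by rw [h])
    obtain ⟨i, hi⟩ := Function.ne_iff.1 hjj
    rw [toSet, toSet, Set.Icc_inter_Icc, Real.volume_Icc_pi]
    refine Finset.prod_eq_zero (Finset.mem_univ i) (ENNReal.ofReal_eq_zero.2 ?_)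
    have hi' : (j i : ℕ) ≠ j' i := fun h => hi (Fin.ext h)
    have := hpos i
    simp only [piece, Pi.sup_apply, Pi.inf_apply, sub_nonpos]
    rcases lt_or_gt_of_ne hi' with h | h
    · refine inf_le_left.trans (le_trans ?_ le_sup_right)
      have : ((j i : ℕ) : ℝ) + 1 ≤ (j' i : ℕ) := by exact_mod_cast h
      gcongr
    · refine inf_le_right.trans (le_trans ?_ le_sup_left)
      have : ((j' i : ℕ) : ℝ) + 1 ≤ (j i : ℕ) := by exact_mod_cast h
      gcongr

end Block

lemma IsBlockPartition.subset {R₀ : Block d} {P : Finset (Block d)} (h : IsBlockPartition R₀ P)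
    {R : Block d} (hR : R ∈ P) : R.toSet ⊆ R₀.toSet := by
  rw [← h.union_eq]
  exact Set.subset_biUnion_of_mem (u := fun R : Block d => R.toSet) hR

lemma isBlockPartition_singleton (R₀ : Block d) : IsBlockPartition R₀ {R₀} :=
  ⟨by simp, fun R hR R' hR' hne => by
    rw [Finset.mem_singleton] at hR hR'
    exact absurd (hR.trans hR'.symm) hne⟩

open Classical in
lemma IsBlockPartition.biUnion {R₀ : Block d} {P : Finset (Block d)} (h : IsBlockPartition R₀ P)
    {S : Block d → Finset (Block d)} (hS : ∀ Q ∈ P, IsBlockPartition Q (S Q)) :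
    IsBlockPartition R₀ (P.biUnion S) := by
  constructor
  · rw [Finset.set_biUnion_biUnion, ← h.union_eq]
    exact Set.iUnion₂_congr fun Q hQ => (hS Q hQ).union_eq
  · intro R hR R' hR' hne
    obtain ⟨Q, hQ, hRQ⟩ := Finset.mem_biUnion.1 hR
    obtain ⟨Q', hQ', hRQ'⟩ := Finset.mem_biUnion.1 hR'
    by_cases hQQ : Q = Q'
    · subst hQQ
      exact (hS Q hQ).null_inter R hRQ R' hRQ' hne
    · exact measure_mono_null (Set.inter_subset_inter ((hS Q hQ).subset hRQ)
        ((hS Q' hQ').subset hRQ')) (h.null_inter Q hQ Q' hQ' hQQ)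

lemma IsBlockPartition.lintegral_eq {R₀ : Block d} {P : Finset (Block d)}
    (h : IsBlockPartition R₀ P) (g : (Fin d → ℝ) → ℝ≥0∞) :
    ∫⁻ x in R₀.toSet, g x = ∑ R ∈ P, ∫⁻ x in R.toSet, g x := by
  rw [← h.union_eq]
  refine lintegral_biUnion_finset₀ (fun R hR R' hR' hne => h.null_inter R hR R' hR' hne)
    (fun R _ => R.measurableSet_toSet.nullMeasurableSet) g

/-- A block can be cut into congruent blocks of arbitrarily small diameter. -/
lemma exists_partition_diam_lt (R₀ : Block d) {δ : ℝ} (hδ : 0 < δ) :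
    ∃ P, IsBlockPartition R₀ P ∧ ∀ R ∈ P, ∀ x ∈ R.toSet, ∀ y ∈ R.toSet, dist x y < δ := by
  have hn : ∀ i, ∃ n : ℕ, 0 < n ∧ R₀.side i / n < δ := fun i => by
    obtain ⟨n, hn⟩ := exists_nat_gt (R₀.side i / δ)
    have hn0 : (0 : ℝ) < n := (div_pos (R₀.side_pos i) hδ).trans hn
    refine ⟨n, by exact_mod_cast hn0, ?_⟩
    rw [div_lt_iff₀ hδ] at hn
    rw [div_lt_iff₀ hn0]
    linarith
  choose n hn0 hn using hn
  refine ⟨R₀.subdivide n, R₀.isBlockPartition_subdivide hn0, fun R hR x hx y hy => ?_⟩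
  rw [dist_pi_lt_iff hδ]
  intro i
  have h := hn i
  rw [← Block.side_of_mem_subdivide hR i, Block.side] at h
  rw [Real.dist_eq, abs_lt]
  have := hx.1 i; have := hx.2 i; have := hy.1 i; have := hy.2 i
  constructor <;> linarith

/-- On a finite union of sets on each of which the `L_p` norm is at most `B`, the `L_p` norm is at
most `N ^ (1 / p) * B`, where `N` bounds the number of sets. For `p = ∞` the exponent
`(1 / p).toReal` is `0`, as it should be. -/
lemma eLpNorm_biUnion_le {p : ℝ≥0∞} (hp : 1 ≤ p) (P : Finset (Block d)) (g : (Fin d → ℝ) → ℝ)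
    {N : ℕ} (hN : P.card ≤ N) {B : ℝ≥0∞}
    (hB : ∀ R ∈ P, eLpNorm g p (volume.restrict R.toSet) ≤ B) :
    eLpNorm g p (volume.restrict (⋃ R ∈ P, R.toSet)) ≤ (N : ℝ≥0∞) ^ (1 / p).toReal * B := by
  have hp0 : p ≠ 0 := (zero_lt_one.trans_le hp).ne'
  by_cases hpt : p = ⊤
  · subst hpt
    simp only [eLpNorm_exponent_top] at hB ⊢
    simp only [ENNReal.div_top, ENNReal.toReal_zero, ENNReal.rpow_zero, one_mul]
    refine eLpNormEssSup_le_of_ae_enorm_bound ?_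
    rw [ae_restrict_biUnion_finset_iff]
    exact fun R hR => (ae_le_eLpNormEssSup (f := g)).mono fun x hx => hx.trans (hB R hR)
  · have hpr : 0 < p.toReal := ENNReal.toReal_pos hp0 hpt
    simp only [eLpNorm_eq_lintegral_rpow_enorm_toReal hp0 hpt] at hB ⊢
    have hB' : ∀ R ∈ P, ∫⁻ x in R.toSet, ‖g x‖ₑ ^ p.toReal ≤ B ^ p.toReal := fun R hR => by
      have := ENNReal.rpow_le_rpow (hB R hR) hpr.le
      rwa [← ENNReal.rpow_mul, one_div_mul_cancel hpr.ne', ENNReal.rpow_one] at this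
    have key : ∫⁻ x in ⋃ R ∈ P, R.toSet, ‖g x‖ₑ ^ p.toReal ≤ N * B ^ p.toReal :=
      calc ∫⁻ x in ⋃ R ∈ P, R.toSet, ‖g x‖ₑ ^ p.toReal
          ≤ ∑ R ∈ P, ∫⁻ x in R.toSet, ‖g x‖ₑ ^ p.toReal := by
            rw [← lintegral_finsetSum_measure]
            refine lintegral_mono' ?_ le_rfl
            have h := Measure.restrict_biUnion_le (μ := (volume : Measure (Fin d → ℝ)))
              (s := fun R : Block d => R.toSet) (T := (P : Set (Block d))) P.countable_toSet
            refine h.trans (le_of_eq ?_)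
            ext s hs
            rw [Measure.sum_apply _ hs, Measure.finsetSum_apply]
            exact Finset.tsum_subtype' P fun R => (volume.restrict R.toSet) s
        _ ≤ ∑ _R ∈ P, B ^ p.toReal := Finset.sum_le_sum hB'
        _ = P.card * B ^ p.toReal := by simp
        _ ≤ N * B ^ p.toReal := by gcongr
    calc _ ≤ (N * B ^ p.toReal) ^ (1 / p.toReal) := ENNReal.rpow_le_rpow key (by positivity)
      _ = _ := by
        rw [ENNReal.mul_rpow_of_nonneg _ _ (by positivity), ← ENNReal.rpow_mul,
          mul_one_div_cancel hpr.ne', ENNReal.rpow_one, one_div, one_div, ENNReal.toReal_inv]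

/-! ### Polynomials on a block -/

lemma mem_polyPStar {k : ℕ} {q : MvPolynomial (Fin d) ℝ} (h : q.totalDegree ≤ k + 1)
    (h' : ∀ i, q.degreeOf i ≤ k) : q ∈ polyPStar d k := by
  rw [q.as_sum]
  refine Submodule.sum_mem _ fun α hα => ?_
  rw [← mul_one (q.coeff α), ← smul_eq_mul, ← MvPolynomial.smul_monomial]
  refine Submodule.smul_mem _ _ (Submodule.subset_span ⟨α, fun i => ?_, ?_, rfl⟩)
  · exact (MvPolynomial.monomial_le_degreeOf i hα).trans (h' i)
  · have := (MvPolynomial.le_totalDegree hα).trans h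
    rwa [Finsupp.sum_fintype _ _ fun _ => rfl] at this

lemma mem_polyPStar_of_totalDegree_le {k : ℕ} {q : MvPolynomial (Fin d) ℝ}
    (h : q.totalDegree ≤ k) : q ∈ polyPStar d k :=
  mem_polyPStar (h.trans k.le_succ) fun i => (q.degreeOf_le_totalDegree i).trans h

/-- The coordinate `i` of the chart of a block, as a polynomial. -/
noncomputable def chartPoly (R : Block d) (i : Fin d) : MvPolynomial (Fin d) ℝ :=
  MvPolynomial.C ((R.lo i + R.hi i) / 2) + MvPolynomial.C (R.side i) * MvPolynomial.X i

lemma eval_chartPoly (R : Block d) (i : Fin d) (t : Fin d → ℝ) :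
    MvPolynomial.eval t (chartPoly R i) = R.chart t i := by
  simp [chartPoly, Block.chart, Block.side]

lemma totalDegree_C_mul_X_le (c : ℝ) (i : Fin d) :
    (MvPolynomial.C c * MvPolynomial.X i : MvPolynomial (Fin d) ℝ).totalDegree ≤ 1 := by
  refine (MvPolynomial.totalDegree_mul _ _).trans ?_
  simp

lemma degreeOf_C_mul_X_le (c : ℝ) (i j : Fin d) :
    (MvPolynomial.C c * MvPolynomial.X i : MvPolynomial (Fin d) ℝ).degreeOf j ≤
      if j = i then 1 else 0 := by
  refine (MvPolynomial.degreeOf_C_mul_le _ _ _).trans ?_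
  rw [MvPolynomial.degreeOf_X]

lemma totalDegree_chartPoly_le (R : Block d) (i : Fin d) : (chartPoly R i).totalDegree ≤ 1 := by
  refine (MvPolynomial.totalDegree_add _ _).trans (max_le ?_ (totalDegree_C_mul_X_le _ _))
  simp

lemma degreeOf_chartPoly_le (R : Block d) (i j : Fin d) :
    (chartPoly R i).degreeOf j ≤ if j = i then 1 else 0 := by
  refine (MvPolynomial.degreeOf_add_le _ _ _).trans (max_le ?_ (degreeOf_C_mul_X_le _ _ _))
  simp

/-- Read in the chart of a block, a monomial of degree `k + 1` is, modulo `P_k^*`, a multiple of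
`X_i ^ (k + 1)` if it is the monomial `X_i ^ (k + 1)`, and `0` otherwise. -/
lemma exists_monomial_chart (R : Block d) {k : ℕ} {α : Fin d →₀ ℕ} (hα : ∑ i, α i = k + 1) (c : ℝ) :
    ∃ q ∈ polyPStar d k, ∀ t, MvPolynomial.eval (R.chart t) (MvPolynomial.monomial α c) =
      MvPolynomial.eval t q +
        ∑ i, if α = Finsupp.single i (k + 1) then c * (R.side i * t i) ^ (k + 1) else 0 := by
  by_cases h : ∃ i, α = Finsupp.single i (k + 1)
  · obtain ⟨i, rfl⟩ := h
    -- `(c + s X) ^ (k + 1) - (s X) ^ (k + 1)` has degree at most `k`.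
    set x : MvPolynomial (Fin d) ℝ := MvPolynomial.C (R.side i) * MvPolynomial.X i with hx
    refine ⟨MvPolynomial.C c * ((∑ l ∈ Finset.range (k + 1), chartPoly R i ^ l * x ^ (k - l)) *
      (chartPoly R i - x)), mem_polyPStar_of_totalDegree_le ?_, fun t => ?_⟩
    · have h1 : chartPoly R i - x = MvPolynomial.C ((R.lo i + R.hi i) / 2) := by
        rw [chartPoly, hx, add_sub_cancel_right]
      rw [h1]
      refine (MvPolynomial.totalDegree_mul _ _).trans ?_
      rw [MvPolynomial.totalDegree_C, zero_add]
      refine (MvPolynomial.totalDegree_mul _ _).trans ?_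
      rw [MvPolynomial.totalDegree_C, add_zero]
      refine MvPolynomial.totalDegree_finsetSum_le fun l hl => ?_
      have hl' : l ≤ k := Nat.lt_succ_iff.1 (Finset.mem_range.1 hl)
      calc _ ≤ _ := MvPolynomial.totalDegree_mul _ _
        _ ≤ l * 1 + (k - l) * 1 := by
          gcongr
          · exact (MvPolynomial.totalDegree_pow _ _).trans
              (Nat.mul_le_mul_left _ (totalDegree_chartPoly_le R i))
          · exact (MvPolynomial.totalDegree_pow _ _).trans
              (Nat.mul_le_mul_left _ (totalDegree_C_mul_X_le _ i))
        _ = k := by omega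
    · have h2 := (Commute.all (chartPoly R i) x).geom_sum₂_mul (k + 1)
      simp only [Nat.add_sub_cancel] at h2
      have h3 : ∀ l, k - l = k + 1 - 1 - l := fun l => by omega
      simp only [h3] at h2 ⊢
      rw [h2]
      have hinj : ∀ j, Finsupp.single i (k + 1) = Finsupp.single j (k + 1) ↔ i = j := fun j =>
        ⟨fun h => (Finsupp.single_left_inj (Nat.succ_ne_zero k)).1 h, fun h => by rw [h]⟩
      simp only [hinj, Finset.sum_ite_eq, Finset.mem_univ, if_true, map_mul, map_sub, map_pow,
        MvPolynomial.eval_C, MvPolynomial.eval_X, eval_chartPoly, hx, MvPolynomial.eval_monomial]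
      have h4 : ((Finsupp.single i (k + 1)).prod fun n e => R.chart t n ^ e) =
          R.chart t i ^ (k + 1) := Finsupp.prod_single_index (pow_zero _)
      rw [h4]
      ring
  · refine ⟨MvPolynomial.C c * ∏ i, chartPoly R i ^ α i, mem_polyPStar ?_ fun j => ?_, fun t => ?_⟩
    · refine (MvPolynomial.totalDegree_mul _ _).trans ?_
      rw [MvPolynomial.totalDegree_C, zero_add, ← hα]
      refine (MvPolynomial.totalDegree_finsetProd _ _).trans (Finset.sum_le_sum fun i _ => ?_)
      refine (MvPolynomial.totalDegree_pow _ _).trans ?_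
      simpa using Nat.mul_le_mul_left (α i) (totalDegree_chartPoly_le R i)
    · have hj : α j ≤ k := by
        by_contra hlt
        refine h ⟨j, Finsupp.ext fun i => ?_⟩
        have h1 := Finset.add_sum_erase Finset.univ (fun i => α i) (Finset.mem_univ j)
        by_cases hij : j = i
        · subst hij
          rw [Finsupp.single_eq_same]
          omega
        · rw [Finsupp.single_eq_of_ne (Ne.symm hij)]
          have h2 := Finset.single_le_sum (f := fun i => α i) (fun _ _ => Nat.zero_le _)
            (Finset.mem_erase.2 ⟨Ne.symm hij, Finset.mem_univ i⟩)
          omega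
      refine (MvPolynomial.degreeOf_C_mul_le _ _ _).trans
        ((MvPolynomial.degreeOf_prod_le _ _ _).trans (le_trans ?_ hj))
      calc _ ≤ ∑ i, α i * (if j = i then 1 else 0) := Finset.sum_le_sum fun i _ =>
            (MvPolynomial.degreeOf_pow_le _ _ _).trans
              (Nat.mul_le_mul_left _ (degreeOf_chartPoly_le R i j))
        _ = α j := by simp
    · push Not at h
      simp only [h, if_false, Finset.sum_const_zero, add_zero, map_mul, MvPolynomial.eval_C,
        map_prod, map_pow, eval_chartPoly, MvPolynomial.eval_monomial]
      rw [Finsupp.prod_fintype _ _ fun i => pow_zero _]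

/-- The coefficients of the pure powers `X_i ^ m` in `d^m f (x) / m!`. -/
noncomputable def pureCoeff (m : ℕ) (f : (Fin d → ℝ) → ℝ) (S : Set (Fin d → ℝ)) (x : Fin d → ℝ)
    (i : Fin d) : ℝ :=
  iteratedFDerivWithin ℝ m f S x (fun _ => Pi.single i 1) / (m.factorial : ℝ)

lemma dirs_single (i : Fin d) (m : ℕ) : dirs (Finsupp.single i m) = List.replicate m i := by
  have h : ∀ l : List (Fin d), l.Nodup →
      l.flatMap (fun j => List.replicate (Finsupp.single i m j) j) =
        if i ∈ l then List.replicate m i else [] := by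
    intro l hl
    induction l with
    | nil => simp
    | cons a l ih =>
      rw [List.nodup_cons] at hl
      rw [List.flatMap_cons, ih hl.2]
      by_cases hia : i = a
      · subst hia
        simp [hl.1]
      · simp [hia, Finsupp.single_eq_of_ne (Ne.symm hia)]
  rw [dirs, h _ (List.nodup_finRange d), if_pos (List.mem_finRange i)]

lemma partialDeriv_single (f : (Fin d → ℝ) → ℝ) (S : Set (Fin d → ℝ)) (i : Fin d) (m : ℕ)
    (x : Fin d → ℝ) : partialDeriv f S (Finsupp.single i m) x =
      iteratedFDerivWithin ℝ m f S x fun _ => Pi.single i 1 := by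
  have h : ∀ (n : ℕ) (_ : n = m) (w : Fin n → Fin d → ℝ), (∀ l, w l = Pi.single i 1) →
      iteratedFDerivWithin ℝ n f S x w = iteratedFDerivWithin ℝ m f S x fun _ => Pi.single i 1 := by
    rintro _ rfl w hw
    rw [funext hw]
  refine h _ (by rw [dirs_single, List.length_replicate]) _ fun l => ?_
  have : (dirs (Finsupp.single i m)).get l = i :=
    List.eq_of_mem_replicate (n := m) (by rw [← dirs_single]; exact List.get_mem _ l)
  rw [this]

lemma exists_taylorHom_chart (R : Block d) (k : ℕ) (f : (Fin d → ℝ) → ℝ) (S : Set (Fin d → ℝ))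
    (x : Fin d → ℝ) :
    ∃ q ∈ polyPStar d k, ∀ t, MvPolynomial.eval (R.chart t) (taylorHom (k + 1) f S x) =
      MvPolynomial.eval t q +
        ∑ i, pureCoeff (k + 1) f S x i * R.side i ^ (k + 1) * t i ^ (k + 1) := by
  set c : (Fin d →₀ ℕ) → ℝ := fun α => partialDeriv f S α x / ∏ i, ((α i).factorial : ℝ) with hc
  have hc1 : ∀ i, c (Finsupp.single i (k + 1)) = pureCoeff (k + 1) f S x i := fun i => by
    simp only [hc, partialDeriv_single, pureCoeff]
    congr 1
    rw [Finset.prod_eq_single i (fun j _ hj => by simp [Finsupp.single_eq_of_ne hj]) (by simp),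
      Finsupp.single_eq_same]
  have hex : ∀ α : Fin d →₀ ℕ, ∃ q ∈ polyPStar d k,
      α ∈ Finset.finsuppAntidiag Finset.univ (k + 1) →
      ∀ t, MvPolynomial.eval (R.chart t) (MvPolynomial.monomial α (c α)) = MvPolynomial.eval t q +
        ∑ i, if α = Finsupp.single i (k + 1) then c α * (R.side i * t i) ^ (k + 1) else 0 := by
    intro α
    by_cases hα : ∑ i, α i = k + 1
    · obtain ⟨q, hq, h⟩ := exists_monomial_chart R hα (c α)
      exact ⟨q, hq, fun _ => h⟩
    · exact ⟨0, Submodule.zero_mem _, fun h => absurd (Finset.mem_finsuppAntidiag.1 h).1 hα⟩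
  choose q hq h using hex
  refine ⟨∑ α ∈ Finset.finsuppAntidiag Finset.univ (k + 1), q α,
    Submodule.sum_mem _ fun α _ => hq α, fun t => ?_⟩
  rw [taylorHom, map_sum, map_sum, Finset.sum_congr rfl fun α hα => h α hα t,
    Finset.sum_add_distrib, Finset.sum_comm]
  congr 1
  refine Finset.sum_congr rfl fun i _ => ?_
  rw [Finset.sum_ite_eq' _ (Finsupp.single i (k + 1)) fun α => c α * (R.side i * t i) ^ (k + 1),
    if_pos, hc1, mul_pow, mul_assoc]
  rw [Finset.mem_finsuppAntidiag]
  simp only [Finsupp.single_apply, Finset.sum_ite_eq, Finset.mem_univ, if_true,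
    Finset.subset_univ, and_self]

/-! ### Taylor expansion on a block -/

lemma multilinear_apply_const {n : ℕ}
    (D : ContinuousMultilinearMap ℝ (fun _ : Fin n => Fin d → ℝ) ℝ) (v : Fin d → ℝ) :
    D (fun _ => v) = ∑ r : Fin n → Fin d, (∏ l, v (r l)) * D fun l => Pi.single (r l) 1 := by
  classical
  have hv : v = ∑ i, v i • (Pi.single i 1 : Fin d → ℝ) := by
    conv_lhs => rw [← Finset.univ_sum_single v]
    exact Finset.sum_congr rfl fun i _ => by rw [← Pi.single_smul, smul_eq_mul, mul_one]
  conv_lhs => rw [hv]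
  rw [D.map_sum]
  refine Finset.sum_congr rfl fun r _ => ?_
  rw [D.map_smul_univ, smul_eq_mul]

lemma exists_multilinear_low {n : ℕ}
    (D : ContinuousMultilinearMap ℝ (fun _ : Fin n => Fin d → ℝ) ℝ) (s : Fin d → ℝ) :
    ∃ q : MvPolynomial (Fin d) ℝ, q.totalDegree ≤ n ∧
      ∀ t : Fin d → ℝ, D (fun _ => s * t) = MvPolynomial.eval t q := by
  refine ⟨∑ r : Fin n → Fin d, (∏ l, MvPolynomial.C (s (r l)) * MvPolynomial.X (r l)) *
    MvPolynomial.C (D fun l => Pi.single (r l) 1), ?_, fun t => ?_⟩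
  · refine MvPolynomial.totalDegree_finsetSum_le fun r _ => ?_
    refine (MvPolynomial.totalDegree_mul _ _).trans ?_
    rw [MvPolynomial.totalDegree_C, add_zero]
    refine (MvPolynomial.totalDegree_finsetProd _ _).trans ?_
    refine (Finset.sum_le_sum fun l _ => totalDegree_C_mul_X_le _ _).trans ?_
    simp
  · rw [multilinear_apply_const]
    simp [map_sum, map_prod]

/-- Modulo `P_k^*`, a form of degree `k + 1` is a combination of pure powers. -/
lemma exists_multilinear_top {k : ℕ}
    (D : ContinuousMultilinearMap ℝ (fun _ : Fin (k + 1) => Fin d → ℝ) ℝ) (s : Fin d → ℝ) :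
    ∃ q ∈ polyPStar d k, ∀ t : Fin d → ℝ, D (fun _ => s * t) = MvPolynomial.eval t q +
      ∑ i, D (fun _ => Pi.single i 1) * s i ^ (k + 1) * t i ^ (k + 1) := by
  have hex : ∀ r : Fin (k + 1) → Fin d, ∃ q ∈ polyPStar d k, ∀ t : Fin d → ℝ,
      (∏ l, (s * t) (r l)) * D (fun l => Pi.single (r l) 1) = MvPolynomial.eval t q +
        ∑ i, if r = fun _ => i then D (fun _ => Pi.single i 1) * s i ^ (k + 1) * t i ^ (k + 1)
          else 0 := by
    intro r
    by_cases h : ∃ i, r = fun _ => i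
    · obtain ⟨i, rfl⟩ := h
      refine ⟨0, Submodule.zero_mem _, fun t => ?_⟩
      have hinj : ∀ j, ((fun _ : Fin (k + 1) => i) = fun _ => j) ↔ i = j := fun j =>
        ⟨fun h => congrFun h 0, fun h => by rw [h]⟩
      simp only [hinj, Finset.sum_ite_eq, Finset.mem_univ, if_true, Finset.prod_const,
        Finset.card_univ, Fintype.card_fin, Pi.mul_apply, map_zero]
      ring
    · refine ⟨(∏ l, MvPolynomial.C (s (r l)) * MvPolynomial.X (r l)) *
        MvPolynomial.C (D fun l => Pi.single (r l) 1), mem_polyPStar ?_ fun i => ?_, fun t => ?_⟩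
      · refine (MvPolynomial.totalDegree_mul _ _).trans ?_
        rw [MvPolynomial.totalDegree_C, add_zero]
        refine (MvPolynomial.totalDegree_finsetProd _ _).trans ?_
        refine (Finset.sum_le_sum fun l _ => totalDegree_C_mul_X_le _ _).trans ?_
        simp
      · refine (MvPolynomial.degreeOf_mul_C_le _ _ _).trans
          ((MvPolynomial.degreeOf_prod_le _ _ _).trans ?_)
        refine (Finset.sum_le_sum fun l _ => degreeOf_C_mul_X_le _ _ _).trans ?_
        rw [Finset.sum_boole, Nat.cast_id]
        obtain ⟨l, hl⟩ : ∃ l, r l ≠ i := by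
          by_contra hcon
          push Not at hcon
          exact h ⟨i, funext hcon⟩
        refine Nat.lt_succ_iff.1 ((Finset.card_lt_univ_of_notMem (x := l) ?_).trans_eq (by simp))
        simp [hl.symm]
      · push Not at h
        simp [h, map_prod]
  choose q hq h using hex
  refine ⟨∑ r, q r, Submodule.sum_mem _ fun r _ => hq r, fun t => ?_⟩
  rw [multilinear_apply_const, map_sum, Finset.sum_congr rfl fun r _ => h r t,
    Finset.sum_add_distrib, Finset.sum_comm]
  simp

lemma iteratedDerivWithin_line {S : Set (Fin d → ℝ)} (hS : UniqueDiffOn ℝ S)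
    {f : (Fin d → ℝ) → ℝ} {m : ℕ} (hf : ContDiffOn ℝ m f S) {c v : Fin d → ℝ}
    (hline : ∀ t ∈ Set.Icc (0 : ℝ) 1, c + t • v ∈ S) (j : ℕ) (hj : j ≤ m) :
    ∀ t ∈ Set.Icc (0 : ℝ) 1, iteratedDerivWithin j (fun t : ℝ => f (c + t • v)) (Set.Icc 0 1) t =
      iteratedFDerivWithin ℝ j f S (c + t • v) fun _ => v := by
  induction j with
  | zero => intro t _; simp
  | succ j ih =>
    intro t ht
    have hd : HasFDerivWithinAt (iteratedFDerivWithin ℝ j f S)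
        (fderivWithin ℝ (iteratedFDerivWithin ℝ j f S) S (c + t • v)) S (c + t • v) :=
      (hf.differentiableOn_iteratedFDerivWithin (by exact_mod_cast hj) hS _
        (hline t ht)).hasFDerivWithinAt
    have hl : HasDerivWithinAt (fun t : ℝ => c + t • v) v (Set.Icc 0 1) t := by
      have := ((hasDerivWithinAt_id t (Set.Icc (0 : ℝ) 1)).smul_const v).const_add c
      simpa using this
    have hcomp := hd.comp_hasDerivWithinAt t hl hline
    have happ := ((ContinuousMultilinearMap.apply ℝ (fun _ : Fin j => Fin d → ℝ) ℝ
      (fun _ => v)).hasFDerivAt.comp_hasDerivWithinAt t hcomp)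
    rw [iteratedDerivWithin_succ, derivWithin_congr (ih (by omega)) (ih (by omega) t ht),
      iteratedFDerivWithin_succ_apply_left]
    exact happ.derivWithin (uniqueDiffOn_Icc zero_lt_one t ht)

/-- Taylor's formula along a segment, with the Lagrange form of the remainder. -/
lemma exists_taylor_segment {S : Set (Fin d → ℝ)} (hS : UniqueDiffOn ℝ S)
    {f : (Fin d → ℝ) → ℝ} {k : ℕ} (hf : ContDiffOn ℝ (k + 1 : ℕ) f S) {c v : Fin d → ℝ}
    (hline : ∀ t ∈ Set.Icc (0 : ℝ) 1, c + t • v ∈ S) :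
    ∃ t ∈ Set.Icc (0 : ℝ) 1, f (c + v) =
      ∑ j ∈ Finset.range (k + 1), (j.factorial : ℝ)⁻¹ * iteratedFDerivWithin ℝ j f S c (fun _ => v)
        + iteratedFDerivWithin ℝ (k + 1) f S (c + t • v) (fun _ => v) / (k + 1).factorial := by
  set φ : ℝ → ℝ := fun t => f (c + t • v) with hφ
  have hcd : ContDiffOn ℝ (k + 1 : ℕ) φ (Set.Icc 0 1) :=
    hf.comp (contDiff_const.add (contDiff_id.smul contDiff_const)).contDiffOn hline
  have hu := uniqueDiffOn_Icc (zero_lt_one (α := ℝ))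
  have hI : Set.uIcc (0 : ℝ) 1 = Set.Icc 0 1 := Set.uIcc_of_le zero_le_one
  obtain ⟨t, ht, h⟩ := taylor_mean_remainder_lagrange (f := φ) (n := k) (zero_ne_one (α := ℝ))
    (by rw [hI]; exact hcd.of_le (by exact_mod_cast k.le_succ))
    (by
      rw [hI]
      refine (hcd.differentiableOn_iteratedDerivWithin (by exact_mod_cast k.lt_succ_self) hu).mono ?_
      rw [← hI]
      exact Set.uIoo_subset_uIcc_self)
  have ht' : t ∈ Set.Icc (0 : ℝ) 1 := hI ▸ Set.uIoo_subset_uIcc_self ht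
  refine ⟨t, ht', ?_⟩
  rw [hI, taylor_within_apply, iteratedDerivWithin_line hS hf hline _ le_rfl t ht'] at h
  have h1 : φ 1 = f (c + v) := by simp [hφ]
  have h0 : ∀ j ∈ Finset.range (k + 1), (((j.factorial : ℝ)⁻¹ * (1 - 0) ^ j) •
      iteratedDerivWithin j φ (Set.Icc 0 1) 0) =
      (j.factorial : ℝ)⁻¹ * iteratedFDerivWithin ℝ j f S c (fun _ => v) := fun j hj => by
    rw [iteratedDerivWithin_line hS hf hline j (Finset.mem_range.1 hj).le 0 (by simp)]
    simp
  rw [Finset.sum_congr rfl h0, h1] at h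
  simp only [sub_zero, one_pow, mul_one] at h
  linarith

lemma chart_mem (R : Block d) {t : Fin d → ℝ} (ht : t ∈ cube d) : R.chart t ∈ R.toSet := by
  constructor <;> intro i <;> have h1 := ht.1 i <;> have h2 := ht.2 i <;> have h3 := R.lt i <;>
    simp only [Block.chart] at * <;> nlinarith

lemma continuous_chart (R : Block d) : Continuous R.chart := by
  unfold Block.chart
  fun_prop

/-- On a small block `R`, a function of class `C^(k+1)` is, up to an element of `P_k^*` and to a
small error, a combination of the pure powers `X_i ^ (k + 1)`, whose coefficients are those of its
differential of order `k + 1` at a nearby point `z`. -/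
lemma exists_poly_approx {R R₀ : Block d} (hR : R.toSet ⊆ R₀.toSet) {f : (Fin d → ℝ) → ℝ} {k : ℕ}
    (hf : ContDiffOn ℝ (k + 1 : ℕ) f R₀.toSet) (z : Fin d → ℝ) {ω B : ℝ}
    (hω : ∀ y ∈ R.toSet, ‖iteratedFDerivWithin ℝ (k + 1) f R₀.toSet y -
      iteratedFDerivWithin ℝ (k + 1) f R₀.toSet z‖ ≤ ω)
    (hB0 : 0 ≤ B) (hB : ∀ i, R.side i ≤ B) :
    ∃ q ∈ polyPStar d k, ∀ t ∈ cube d, |f (R.chart t) - (MvPolynomial.eval t q +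
      ∑ i, pureCoeff (k + 1) f R₀.toSet z i * R.side i ^ (k + 1) * t i ^ (k + 1))| ≤
        ω * B ^ (k + 1) := by
  set c : Fin d → ℝ := fun i => (R.lo i + R.hi i) / 2 with hc
  have hchart : ∀ t, R.chart t = c + R.side * t := fun t => by
    ext i
    simp [Block.chart, Block.side, hc]
  have hlow : ∀ j : ℕ, ∃ q : MvPolynomial (Fin d) ℝ, q.totalDegree ≤ j ∧ ∀ t : Fin d → ℝ,
      iteratedFDerivWithin ℝ j f R₀.toSet c (fun _ => R.side * t) = MvPolynomial.eval t q :=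
    fun j => exists_multilinear_low _ _
  choose q hq hqe using hlow
  obtain ⟨q', hq', hqe'⟩ :=
    exists_multilinear_top (iteratedFDerivWithin ℝ (k + 1) f R₀.toSet z) R.side
  refine ⟨∑ j ∈ Finset.range (k + 1), (j.factorial : ℝ)⁻¹ • q j + ((k + 1).factorial : ℝ)⁻¹ • q',
    Submodule.add_mem _ (Submodule.sum_mem _ fun j hj => Submodule.smul_mem _ _ ?_)
      (Submodule.smul_mem _ _ hq'), fun t ht => ?_⟩
  · exact mem_polyPStar_of_totalDegree_le
      ((hq j).trans (Nat.lt_succ_iff.1 (Finset.mem_range.1 hj)))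
  have hmem : ∀ a ∈ Set.Icc (0 : ℝ) 1, c + a • (R.side * t) ∈ R.toSet := fun a ha => by
    have h : c + a • (R.side * t) = R.chart (a • t) := by
      rw [hchart, mul_smul_comm]
    rw [h]
    refine chart_mem R ⟨fun i => ?_, fun i => ?_⟩ <;> have h1 := ht.1 i <;> have h2 := ht.2 i <;>
      simp only [Pi.smul_apply, smul_eq_mul] <;> nlinarith [ha.1, ha.2]
  obtain ⟨a, ha, hT⟩ := exists_taylor_segment R₀.uniqueDiffOn_toSet hf
    (fun a ha => hR (hmem a ha))
  have hfac : (1 : ℝ) ≤ (k + 1).factorial := by exact_mod_cast Nat.factorial_pos _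
  have hv : ‖R.side * t‖ ≤ B := by
    rw [pi_norm_le_iff_of_nonneg hB0]
    intro i
    have h1 : |t i| ≤ 1 := abs_le.2 ⟨by linarith [ht.1 i], by linarith [ht.2 i]⟩
    rw [Pi.mul_apply, norm_mul, Real.norm_eq_abs, Real.norm_eq_abs, abs_of_pos (R.side_pos i)]
    nlinarith [hB i, R.side_pos i, abs_nonneg (t i)]
  have hrem : |(iteratedFDerivWithin ℝ (k + 1) f R₀.toSet (c + a • (R.side * t)) -
      iteratedFDerivWithin ℝ (k + 1) f R₀.toSet z) fun _ => R.side * t| ≤ ω * B ^ (k + 1) := by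
    have hop := (iteratedFDerivWithin ℝ (k + 1) f R₀.toSet (c + a • (R.side * t)) -
      iteratedFDerivWithin ℝ (k + 1) f R₀.toSet z).le_opNorm fun _ => R.side * t
    refine hop.trans ?_
    have hprod : ∏ _l : Fin (k + 1), ‖R.side * t‖ = ‖R.side * t‖ ^ (k + 1) := by simp
    rw [hprod]
    gcongr
    · exact (norm_nonneg _).trans (hω _ (hmem a ha))
    · exact hω _ (hmem a ha)
  have hkey : f (R.chart t) - (MvPolynomial.eval t (∑ j ∈ Finset.range (k + 1),
      (j.factorial : ℝ)⁻¹ • q j + ((k + 1).factorial : ℝ)⁻¹ • q') +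
      ∑ i, pureCoeff (k + 1) f R₀.toSet z i * R.side i ^ (k + 1) * t i ^ (k + 1)) =
      ((iteratedFDerivWithin ℝ (k + 1) f R₀.toSet (c + a • (R.side * t)) -
        iteratedFDerivWithin ℝ (k + 1) f R₀.toSet z) fun _ => R.side * t) / (k + 1).factorial := by
    have hsum : ∑ i, pureCoeff (k + 1) f R₀.toSet z i * R.side i ^ (k + 1) * t i ^ (k + 1) =
        (∑ i, iteratedFDerivWithin ℝ (k + 1) f R₀.toSet z (fun _ => Pi.single i 1) *
          R.side i ^ (k + 1) * t i ^ (k + 1)) / (k + 1).factorial := by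
      rw [Finset.sum_div]
      exact Finset.sum_congr rfl fun i _ => by rw [pureCoeff]; ring
    rw [hchart, hT, hsum, _root_.sub_apply, hqe']
    simp only [map_add, map_sum, MvPolynomial.smul_eval, ← hqe]
    ring
  rw [hkey, abs_div, abs_of_pos (zero_lt_one.trans_le hfac)]
  exact (div_le_self (abs_nonneg _) hfac).trans hrem

/-! ### The interpolation error on a block -/

/-- Lebesgue measure on the canonical block. -/
noncomputable def cubeMeasure (d : ℕ) : Measure (cube d) :=
  Measure.comap Subtype.val volume

namespace Block

lemma map_chart_volume (R : Block d) :
    ENNReal.ofReal (∏ i, R.side i) • Measure.map R.chart volume = volume := by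
  have hdet : (Matrix.diagonal R.side).det = ∏ i, R.side i := Matrix.det_diagonal
  have hpos := R.prod_side_pos
  have h := Real.smul_map_diagonal_volume_pi (D := R.side) (by rw [hdet]; exact hpos.ne')
  rw [hdet, abs_of_pos hpos] at h
  have hc : R.chart = (fun x => (fun i => (R.lo i + R.hi i) / 2) + x) ∘
      Matrix.toLin' (Matrix.diagonal R.side) := by
    ext t i
    simp [Block.chart, Matrix.mulVec_diagonal, side]
  have hm : Measurable (Matrix.toLin' (Matrix.diagonal R.side)) :=
    (LinearMap.continuous_of_finiteDimensional _).measurable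
  rw [hc, ← Measure.map_map (measurable_const_add _) hm, ← Measure.map_smul, h,
    map_add_left_eq_self]

lemma chart_mem_iff (R : Block d) (t : Fin d → ℝ) : R.chart t ∈ R.toSet ↔ t ∈ cube d := by
  refine ⟨fun h => ⟨fun i => ?_, fun i => ?_⟩, chart_mem R⟩ <;>
    have h1 := h.1 i <;> have h2 := h.2 i <;> have h3 := R.lt i <;>
    simp only [Block.chart] at * <;> by_contra hlt <;> push Not at hlt <;> nlinarith

lemma chartInv_chart (R : Block d) (t : Fin d → ℝ) : R.chartInv (R.chart t) = t := by
  ext i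
  have := (sub_pos.2 (R.lt i)).ne'
  simp only [chartInv, chart]
  field_simp
  ring

lemma measurableEmbedding_chart (R : Block d) :
    MeasurableEmbedding fun t : cube d => R.chart t := by
  refine Topology.IsClosedEmbedding.measurableEmbedding (Continuous.isClosedEmbedding
    ((continuous_chart R).comp continuous_subtype_val) fun s t h => Subtype.ext ?_)
  have := congrArg R.chartInv h
  simpa only [chartInv_chart] using this

lemma restrict_toSet_eq (R : Block d) : volume.restrict R.toSet =
    ENNReal.ofReal (∏ i, R.side i) • Measure.map (fun t : cube d => R.chart t) (cubeMeasure d) := by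
  have hpre : R.chart ⁻¹' R.toSet = cube d := Set.ext fun t => R.chart_mem_iff t
  have hmeas : MeasurableSet (cube d) := measurableSet_Icc
  conv_lhs => rw [← R.map_chart_volume]
  rw [Measure.restrict_smul, Measure.restrict_map (continuous_chart R).measurable
    R.measurableSet_toSet, hpre, ← map_comap_subtype_coe hmeas,
    Measure.map_map (continuous_chart R).measurable measurable_subtype_coe]
  rfl

end Block

instance : IsFiniteMeasure (cubeMeasure d) :=
  ⟨by
    rw [cubeMeasure, comap_subtype_coe_apply (s := cube d) measurableSet_Icc, Set.image_univ,
      Subtype.range_coe_subtype]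
    exact isCompact_Icc.measure_lt_top⟩

/-- The canonical map from `V` to `L_p` of the canonical block. -/
noncomputable def toLpV (d : ℕ) (p : ℝ≥0∞) [Fact (1 ≤ p)] :
    V d →L[ℝ] Lp ℝ p (cubeMeasure d) :=
  ContinuousMap.toLp p (cubeMeasure d) ℝ

lemma eLpNorm_eq_norm_toLpV (p : ℝ≥0∞) [Fact (1 ≤ p)] (u : V d) :
    eLpNorm u p (cubeMeasure d) = ENNReal.ofReal ‖toLpV d p u‖ := by
  rw [Lp.norm_def, ENNReal.ofReal_toReal (Lp.eLpNorm_ne_top _)]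
  exact eLpNorm_congr_ae (ContinuousMap.coeFn_toLp (p := p) (𝕜 := ℝ) (cubeMeasure d) u).symm

lemma toLpV_injective (p : ℝ≥0∞) [Fact (1 ≤ p)] : Function.Injective (toLpV d p) := by
  have : (cubeMeasure d).IsOpenPosMeasure := by
    refine ⟨fun U hU hne h0 => ?_⟩
    obtain ⟨O, hO, rfl⟩ := isOpen_induced_iff.1 hU
    obtain ⟨x, hx⟩ := hne
    have hcl : cube d ⊆ closure (interior (cube d)) := by
      have hi : (interior (cube d)).Nonempty := by
        refine ⟨0, ?_⟩
        rw [cube, ← Set.pi_univ_Icc, interior_pi_set Set.finite_univ]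
        intro i _
        simp
      have hconv : Convex ℝ (cube d) := convex_Icc _ _
      rw [hconv.closure_interior_eq_closure_of_nonempty_interior hi]
      exact subset_closure
    obtain ⟨y, hyO, hyi⟩ := mem_closure_iff.1 (hcl x.2) O hO hx
    have hpos : 0 < volume (O ∩ interior (cube d)) :=
      (hO.inter isOpen_interior).measure_pos volume ⟨y, hyO, hyi⟩
    have hc : volume (O ∩ cube d) = 0 := by
      have hmeas : MeasurableSet (cube d) := measurableSet_Icc
      rw [← Measure.restrict_apply hO.measurableSet, ← map_comap_subtype_coe hmeas,
        Measure.map_apply measurable_subtype_coe hO.measurableSet]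
      exact h0
    exact hpos.ne' (measure_mono_null (Set.inter_subset_inter_right _ interior_subset) hc)
  exact ContinuousMap.toLp_injective (cubeMeasure d)

lemma interpBlock_chart (I : V d →L[ℝ] V d) (R : Block d) {f : (Fin d → ℝ) → ℝ} {g : V d}
    (hg : ∀ t : cube d, g t = f (R.chart t)) (t : cube d) :
    interpBlock I R f (R.chart t) = I g t := by
  have hgf : (fun t : cube d => f (R.chart t)) = g := funext fun t => (hg t).symm
  have hD : ContinuousMap.mkD (fun t : cube d => f (R.chart t)) 0 = g := by
    ext t
    rw [hgf, ContinuousMap.mkD_apply_of_continuous g.continuous]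
  have hmem : R.chartInv (R.chart t) ∈ cube d := by
    rw [R.chartInv_chart]
    exact t.2
  rw [interpBlock, dif_pos hmem, hD]
  congr 1
  exact Subtype.ext (R.chartInv_chart t)

lemma eLpNorm_interp_error (I : V d →L[ℝ] V d) (p : ℝ≥0∞) [Fact (1 ≤ p)] (R : Block d)
    {f : (Fin d → ℝ) → ℝ} {g : V d} (hg : ∀ t : cube d, g t = f (R.chart t)) :
    eLpNorm (fun x => f x - interpBlock I R f x) p (volume.restrict R.toSet) =
      ENNReal.ofReal (∏ i, R.side i) ^ (1 / p).toReal * ENNReal.ofReal ‖toLpV d p (g - I g)‖ := by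
  rw [R.restrict_toSet_eq, eLpNorm_smul_measure_of_ne_zero
    (ENNReal.ofReal_pos.2 R.prod_side_pos).ne', R.measurableEmbedding_chart.eLpNorm_map_measure,
    ← eLpNorm_eq_norm_toLpV, smul_eq_mul]
  congr 2
  ext t
  simp [interpBlock_chart I R hg, hg]

/-- The interpolation error of `∑ i, μ i * X_i ^ m` on the canonical block. -/
noncomputable def pureErr (I : V d →L[ℝ] V d) (m : ℕ) : (Fin d → ℝ) →L[ℝ] V d :=
  ∑ i, (ContinuousLinearMap.proj i : (Fin d → ℝ) →L[ℝ] ℝ).smulRight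
    (polyV (MvPolynomial.X i ^ m) - I (polyV (MvPolynomial.X i ^ m)))

lemma pureErr_apply (I : V d →L[ℝ] V d) (m : ℕ) (μ : Fin d → ℝ) : pureErr I m μ =
    ∑ i, μ i • (polyV (MvPolynomial.X i ^ m) - I (polyV (MvPolynomial.X i ^ m))) := by
  simp [pureErr, sum_apply]

lemma pureErr_eq (I : V d →L[ℝ] V d) (m : ℕ) (μ : Fin d → ℝ) : pureErr I m μ =
    (∑ i, μ i • polyV (MvPolynomial.X i ^ m)) - I (∑ i, μ i • polyV (MvPolynomial.X i ^ m)) := by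
  rw [pureErr_apply, map_sum, ← Finset.sum_sub_distrib]
  exact Finset.sum_congr rfl fun i _ => by rw [map_smul, smul_sub]

/-- The map `pureErr`, valued in `L_p` of the canonical block. -/
noncomputable def pureErrLp (I : V d →L[ℝ] V d) (p : ℝ≥0∞) [Fact (1 ≤ p)] (m : ℕ) :
    (Fin d → ℝ) →L[ℝ] Lp ℝ p (cubeMeasure d) :=
  (toLpV d p).comp (pureErr I m)

lemma apply_polyV {I : V d →L[ℝ] V d} (hI : ∀ g : V d, I (I g) = I g) {k : ℕ} (hS : HStar I k)
    {q : MvPolynomial (Fin d) ℝ} (hq : q ∈ polyPStar d k) : I (polyV q) = polyV q := by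
  obtain ⟨g, hg⟩ := hS q hq
  rw [← hg, hI]

/-- Up to the error committed on a remainder, interpolation errors only see pure powers. -/
lemma norm_toLpV_sub_pureErrLp_le {I : V d →L[ℝ] V d} (hI : ∀ g : V d, I (I g) = I g) {k : ℕ}
    (hS : HStar I k) (p : ℝ≥0∞) [Fact (1 ≤ p)] {q : MvPolynomial (Fin d) ℝ}
    (hq : q ∈ polyPStar d k) (μ : Fin d → ℝ) (g : V d) {δ : ℝ} (hδ : 0 ≤ δ)
    (h : ∀ t : cube d, |g t - (MvPolynomial.eval t.1 q + ∑ i, μ i * t.1 i ^ (k + 1))| ≤ δ) :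
    ‖toLpV d p (g - I g) - pureErrLp I p (k + 1) μ‖ ≤ ‖toLpV d p‖ * (1 + ‖I‖) * δ := by
  set r : V d := g - polyV q - ∑ i, μ i • polyV (MvPolynomial.X i ^ (k + 1)) with hr
  have hrn : ‖r‖ ≤ δ := by
    rw [ContinuousMap.norm_le _ hδ]
    intro t
    refine le_trans (le_of_eq ?_) (h t)
    rw [Real.norm_eq_abs]
    congr 1
    simp [hr, polyV, ContinuousMap.sum_apply]
    ring
  have hdec : g - I g = pureErr I (k + 1) μ + (r - I r) := by
    rw [pureErr_eq, hr, map_sub, map_sub, apply_polyV hI hS hq]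
    abel
  rw [hdec, map_add, pureErrLp, ContinuousLinearMap.comp_apply, add_sub_cancel_left]
  calc ‖toLpV d p (r - I r)‖ ≤ ‖toLpV d p‖ * ‖r - I r‖ := (toLpV d p).le_opNorm _
    _ ≤ ‖toLpV d p‖ * ((1 + ‖I‖) * δ) := by
      gcongr
      calc ‖r - I r‖ ≤ ‖r‖ + ‖I‖ * ‖r‖ := (norm_sub_le _ _).trans (by gcongr; exact I.le_opNorm r)
        _ = (1 + ‖I‖) * ‖r‖ := by ring
        _ ≤ (1 + ‖I‖) * δ := by gcongr
    _ = _ := by ring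

lemma eLpNorm_taylorHom_error {I : V d →L[ℝ] V d} (hI : ∀ g : V d, I (I g) = I g) {k : ℕ}
    (hS : HStar I k) (p : ℝ≥0∞) [Fact (1 ≤ p)] (R : Block d) (f : (Fin d → ℝ) → ℝ)
    (S : Set (Fin d → ℝ)) (x : Fin d → ℝ) :
    eLpNorm (fun y => MvPolynomial.eval y (taylorHom (k + 1) f S x) -
      interpBlock I R (fun y => MvPolynomial.eval y (taylorHom (k + 1) f S x)) y) p
        (volume.restrict R.toSet) =
      ENNReal.ofReal (∏ i, R.side i) ^ (1 / p).toReal * ENNReal.ofReal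
        ‖pureErrLp I p (k + 1) fun i => pureCoeff (k + 1) f S x i * R.side i ^ (k + 1)‖ := by
  obtain ⟨q, hq, h⟩ := exists_taylorHom_chart R k f S x
  let g : V d := ⟨fun t => MvPolynomial.eval (R.chart t) (taylorHom (k + 1) f S x),
    (MvPolynomial.continuous_eval _).comp ((continuous_chart R).comp continuous_subtype_val)⟩
  rw [eLpNorm_interp_error I p R (g := g) fun _ => rfl]
  have hle := norm_toLpV_sub_pureErrLp_le hI hS p hq
    (fun i => pureCoeff (k + 1) f S x i * R.side i ^ (k + 1)) g le_rfl fun t => by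
      have : g t = MvPolynomial.eval (R.chart t) (taylorHom (k + 1) f S x) := rfl
      rw [this, h, sub_self, abs_zero]
  rw [mul_zero, norm_le_zero_iff, sub_eq_zero] at hle
  rw [hle]

/-- The interpolation error of `f` on a small block, compared to that of its differential of order
`k + 1` at a nearby point `z`. -/
lemma eLpNorm_interp_error_le {I : V d →L[ℝ] V d} (hI : ∀ g : V d, I (I g) = I g) {k : ℕ}
    (hS : HStar I k) (p : ℝ≥0∞) [Fact (1 ≤ p)] {R R₀ : Block d} (hR : R.toSet ⊆ R₀.toSet)
    {f : (Fin d → ℝ) → ℝ} (hf : ContDiffOn ℝ (k + 1 : ℕ) f R₀.toSet) (z : Fin d → ℝ) {ω B : ℝ}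
    (hω : ∀ y ∈ R.toSet, ‖iteratedFDerivWithin ℝ (k + 1) f R₀.toSet y -
      iteratedFDerivWithin ℝ (k + 1) f R₀.toSet z‖ ≤ ω)
    (hB0 : 0 ≤ B) (hB : ∀ i, R.side i ≤ B) :
    eLpNorm (fun x => f x - interpBlock I R f x) p (volume.restrict R.toSet) ≤
      ENNReal.ofReal ((∏ i, R.side i) ^ (1 / p).toReal *
        (‖pureErrLp I p (k + 1) fun i => pureCoeff (k + 1) f R₀.toSet z i * R.side i ^ (k + 1)‖ +
          ‖toLpV d p‖ * (1 + ‖I‖) * (ω * B ^ (k + 1)))) := by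
  obtain ⟨q, hq, h⟩ := exists_poly_approx hR hf z hω hB0 hB
  have hω0 : 0 ≤ ω := (norm_nonneg _).trans (hω _ R.lo_mem)
  let g : V d := ⟨fun t => f (R.chart t), hf.continuousOn.comp_continuous
    ((continuous_chart R).comp continuous_subtype_val) fun t => hR (chart_mem R t.2)⟩
  rw [eLpNorm_interp_error I p R (g := g) fun _ => rfl,
    ENNReal.ofReal_rpow_of_pos R.prod_side_pos, ← ENNReal.ofReal_mul
      (Real.rpow_nonneg R.prod_side_pos.le _)]
  refine ENNReal.ofReal_le_ofReal
    (mul_le_mul_of_nonneg_left ?_ (Real.rpow_nonneg R.prod_side_pos.le _))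
  have hle := norm_toLpV_sub_pureErrLp_le hI hS p hq
    (fun i => pureCoeff (k + 1) f R₀.toSet z i * R.side i ^ (k + 1)) g
    (mul_nonneg hω0 (pow_nonneg hB0 _)) fun t => h t.1 t.2
  calc ‖toLpV d p (g - I g)‖ ≤ _ := norm_le_norm_add_norm_sub' _ (pureErrLp I p (k + 1)
        fun i => pureCoeff (k + 1) f R₀.toSet z i * R.side i ^ (k + 1))
    _ ≤ _ := by gcongr

/-! ### The error function -/

lemma pureErrLp_apply (I : V d →L[ℝ] V d) (p : ℝ≥0∞) [Fact (1 ≤ p)] (m : ℕ) (μ : Fin d → ℝ) :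
    pureErrLp I p m μ = ∑ i, μ i • toLpV d p
      (polyV (MvPolynomial.X i ^ m) - I (polyV (MvPolynomial.X i ^ m))) := by
  rw [pureErrLp, ContinuousLinearMap.comp_apply, pureErr_apply, map_sum]
  simp only [map_smul]

/-- The block with one vertex at the origin and with prescribed side lengths. -/
def blockOfSides (s : Fin d → ℝ) (hs : ∀ i, 0 < s i) : Block d := ⟨0, s, hs⟩

lemma side_blockOfSides (s : Fin d → ℝ) (hs : ∀ i, 0 < s i) : (blockOfSides s hs).side = s := by
  ext i
  simp [blockOfSides, Block.side]

lemma prod_side_eq_one {R : Block d} (hR : volume R.toSet = 1) : ∏ i, R.side i = 1 := by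
  rw [R.volume_toSet, ENNReal.ofReal_eq_one] at hR
  exact hR

lemma polyV_X_pow_comp_signMap {m : ℕ} (hm : Odd m) (ε : Fin d → ℤˣ) (i : Fin d) :
    (polyV (MvPolynomial.X i ^ m)).comp (signMap ε) =
      ((ε i : ℤ) : ℝ) • polyV (MvPolynomial.X i ^ m) := by
  ext t
  rcases Int.units_eq_one_or (ε i) with h | h <;>
    simp [polyV, signMap, h, hm.neg_pow]

/-- When `I` commutes with sign changes and `m` is odd, the nonzero ones among the errors on the
`X_i ^ m` are linearly independent. -/
lemma pureErr_injective_of_odd {m : ℕ} (hm : Odd m) {I : V d →L[ℝ] V d} (hsign : HSign I)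
    (hne : ∀ i, polyV (MvPolynomial.X i ^ m) - I (polyV (MvPolynomial.X i ^ m)) ≠ 0) :
    Function.Injective (pureErr I m) := by
  rw [injective_iff_map_eq_zero]
  intro c hc
  funext j
  set e : Fin d → V d := fun i => polyV (MvPolynomial.X i ^ m) - I (polyV (MvPolynomial.X i ^ m))
    with he
  set ε : Fin d → ℤˣ := fun i => if i = j then -1 else 1 with hε
  have hecomp : ∀ i, (e i).comp (signMap ε) = ((ε i : ℤ) : ℝ) • e i := fun i => by
    have h1 : (e i).comp (signMap ε) = (polyV (MvPolynomial.X i ^ m)).comp (signMap ε) -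
        (I (polyV (MvPolynomial.X i ^ m))).comp (signMap ε) := rfl
    rw [h1, ← hsign, polyV_X_pow_comp_signMap hm, map_smul, smul_sub]
  have h0 : ∑ i, c i • e i = 0 := by rw [← hc, pureErr_apply]
  have h1 : ∑ i, c i • ((ε i : ℤ) : ℝ) • e i = 0 := by
    have h2 : (∑ i, c i • e i).comp (signMap ε) = ∑ i, c i • (e i).comp (signMap ε) := by
      ext t
      simp [ContinuousMap.sum_apply]
    rw [h0] at h2
    simp only [hecomp] at h2
    rw [← h2]
    rfl
  have h3 : ∑ i, (c i • e i - c i • ((ε i : ℤ) : ℝ) • e i) = 0 := by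
    rw [Finset.sum_sub_distrib, h0, h1, sub_zero]
  rw [Finset.sum_eq_single j (fun i _ hij => by simp [hε, hij]) (by simp)] at h3
  have h4 : (2 * c j) • e j = 0 := by
    rw [← h3]
    simp only [hε, if_true, Units.val_neg, Units.val_one, Int.cast_neg, Int.cast_one]
    module
  rcases smul_eq_zero.1 h4 with h | h
  · simpa using h
  · exact absurd h (hne j)

lemma pureErr_injective_of_hStarStar {m : ℕ} {I : V d →L[ℝ] V d} (h : HStarStar I m) :
    Function.Injective (pureErr I m) := by
  rw [injective_iff_map_eq_zero]
  intro c hc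
  refine h c ?_
  have h1 : polyV (∑ i, MvPolynomial.C (c i) * MvPolynomial.X i ^ m) =
      ∑ i, c i • polyV (MvPolynomial.X i ^ m) := by
    ext t
    simp [polyV, ContinuousMap.sum_apply]
  rw [pureErr_eq, sub_eq_zero] at hc
  rw [h1, hc]
  exact ⟨_, rfl⟩

section ErrorFun

variable {I : V d →L[ℝ] V d} {k : ℕ} {p : ℝ≥0∞} [Fact (1 ≤ p)]

lemma errorFun_le (hI : ∀ g : V d, I (I g) = I g) (hS : HStar I k) (f : (Fin d → ℝ) → ℝ)
    (S : Set (Fin d → ℝ)) (x : Fin d → ℝ) {s : Fin d → ℝ} (hs : ∀ i, 0 < s i)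
    (hs1 : ∏ i, s i = 1) : errorFun I p (taylorHom (k + 1) f S x) ≤ ENNReal.ofReal
      ‖pureErrLp I p (k + 1) fun i => pureCoeff (k + 1) f S x i * s i ^ (k + 1)‖ := by
  have hvol : volume (blockOfSides s hs).toSet = 1 := by
    rw [Block.volume_toSet, side_blockOfSides, hs1, ENNReal.ofReal_one]
  refine (iInf₂_le (blockOfSides s hs) hvol).trans (le_of_eq ?_)
  rw [eLpNorm_taylorHom_error hI hS, side_blockOfSides, hs1, ENNReal.ofReal_one, ENNReal.one_rpow,
    one_mul]

lemma le_errorFun (hI : ∀ g : V d, I (I g) = I g) (hS : HStar I k) (f : (Fin d → ℝ) → ℝ)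
    (S : Set (Fin d → ℝ)) (x : Fin d → ℝ) {c : ℝ}
    (h : ∀ s : Fin d → ℝ, (∀ i, 0 < s i) → ∏ i, s i = 1 →
      c ≤ ‖pureErrLp I p (k + 1) fun i => pureCoeff (k + 1) f S x i * s i ^ (k + 1)‖) :
    ENNReal.ofReal c ≤ errorFun I p (taylorHom (k + 1) f S x) := by
  refine le_iInf₂ fun R hR => ?_
  have h1 := prod_side_eq_one hR
  rw [eLpNorm_taylorHom_error hI hS, h1, ENNReal.ofReal_one, ENNReal.one_rpow, one_mul]
  exact ENNReal.ofReal_le_ofReal (h R.side R.side_pos h1)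

/-- If the pure power `X_j ^ (k + 1)` does not contribute to the error, the error function vanishes:
blocks can be stretched in the direction `j`. -/
lemma errorFun_eq_zero (hI : ∀ g : V d, I (I g) = I g) (hS : HStar I k) (f : (Fin d → ℝ) → ℝ)
    (S : Set (Fin d → ℝ)) (x : Fin d → ℝ) (j : Fin d)
    (hj : pureCoeff (k + 1) f S x j • toLpV d p (polyV (MvPolynomial.X j ^ (k + 1)) -
      I (polyV (MvPolynomial.X j ^ (k + 1)))) = 0) :
    errorFun I p (taylorHom (k + 1) f S x) = 0 := by
  set l := pureCoeff (k + 1) f S x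
  have hle : ∀ ε : ℝ, 0 < ε → errorFun I p (taylorHom (k + 1) f S x) ≤
      ENNReal.ofReal (ε ^ (k + 1) * ‖pureErrLp I p (k + 1) l‖) := by
    intro ε hε
    -- All sides are `ε`, except side `j`, which makes the volume equal to `1`.
    set s : Fin d → ℝ := fun i => if i = j then (ε ^ (Finset.univ.erase j).card)⁻¹ else ε with hs
    have hspos : ∀ i, 0 < s i := fun i => by
      simp only [hs]
      split_ifs <;> positivity
    have hs1 : ∏ i, s i = 1 := by
      rw [← Finset.mul_prod_erase _ _ (Finset.mem_univ j)]
      have h1 : ∏ i ∈ Finset.univ.erase j, s i = ε ^ (Finset.univ.erase j).card :=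
        Finset.prod_eq_pow_card fun i hi => by simp [hs, Finset.ne_of_mem_erase hi]
      rw [h1]
      simp only [hs, if_true]
      exact inv_mul_cancel₀ (by positivity)
    refine (errorFun_le hI hS f S x hspos hs1).trans (le_of_eq ?_)
    have h2 : (pureErrLp I p (k + 1) fun i => l i * s i ^ (k + 1)) =
        ε ^ (k + 1) • pureErrLp I p (k + 1) l := by
      rw [pureErrLp_apply, pureErrLp_apply, Finset.smul_sum]
      refine Finset.sum_congr rfl fun i _ => ?_
      by_cases hij : i = j
      · subst hij
        rw [mul_comm, mul_smul, hj, smul_zero, smul_zero]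
      · simp only [hs, if_neg hij]
        rw [mul_comm, mul_smul]
    rw [h2, norm_smul, norm_pow, Real.norm_of_nonneg hε.le]
  have hlim : Tendsto (fun ε : ℝ => ENNReal.ofReal (ε ^ (k + 1) * ‖pureErrLp I p (k + 1) l‖))
      (nhdsWithin 0 (Set.Ioi 0)) (nhds 0) := by
    have hc : Continuous fun ε : ℝ => ENNReal.ofReal (ε ^ (k + 1) * ‖pureErrLp I p (k + 1) l‖) :=
      ENNReal.continuous_ofReal.comp (by fun_prop)
    have := hc.tendsto 0
    simp only [zero_pow (Nat.succ_ne_zero k), zero_mul, ENNReal.ofReal_zero] at this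
    exact this.mono_left nhdsWithin_le_nhds
  refine le_antisymm (ge_of_tendsto hlim ?_) zero_le
  filter_upwards [self_mem_nhdsWithin] with ε hε using hle ε hε

end ErrorFun

/-! ### Optimal blocks -/

/-- If `L` is injective and the `s_i` are `± 1`, then `‖L (s_i a_i ^ m)‖` attains its minimum over
the vectors `a` of positive coordinates of product `1`: this expression is large as soon as one of
the `a_i` is. -/
lemma exists_optimal_sides {F : Type*} [NormedAddCommGroup F] [NormedSpace ℝ F]
    {L : (Fin d → ℝ) →L[ℝ] F} (hL : Function.Injective L) {m : ℕ} (hm : m ≠ 0) (s : Fin d → ℝ)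
    (hs : ∀ i, |s i| = 1) :
    ∃ a : Fin d → ℝ, (∀ i, 0 < a i) ∧ ∏ i, a i = 1 ∧ ∀ b : Fin d → ℝ, (∀ i, 0 < b i) →
      ∏ i, b i = 1 → ‖L fun i => s i * a i ^ m‖ ≤ ‖L fun i => s i * b i ^ m‖ := by
  obtain ⟨C, hC, hCL⟩ := (L : (Fin d → ℝ) →ₗ[ℝ] F).exists_antilipschitzWith
    (LinearMap.ker_eq_bot.2 hL)
  have hbound : ∀ b : Fin d → ℝ, (∀ i, 0 < b i) →
      ∀ i, b i ^ m ≤ C * ‖L fun i => s i * b i ^ m‖ := by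
    intro b hb i
    have h1 := hCL.le_mul_dist (fun i => s i * b i ^ m) 0
    rw [map_zero, dist_zero_right, dist_zero_right] at h1
    refine le_trans (le_of_eq ?_) ((norm_le_pi_norm (fun i => s i * b i ^ m) i).trans h1)
    rw [norm_mul, Real.norm_eq_abs, hs, one_mul, Real.norm_of_nonneg (pow_nonneg (hb i).le _)]
  set M : ℝ := max 1 (C * ‖L s‖) with hM
  have hM1 : 1 ≤ M := le_max_left _ _
  have hLs : (fun i => s i * (1 : Fin d → ℝ) i ^ m) = s := by
    ext i
    simp
  have hcont : Continuous fun a : Fin d → ℝ => ‖L fun i => s i * a i ^ m‖ :=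
    (L.continuous.comp (by fun_prop)).norm
  have hcomp : IsCompact (Set.Icc (0 : Fin d → ℝ) (fun _ => M) ∩ {a | ∏ i, a i = 1}) :=
    isCompact_Icc.inter_right (isClosed_eq (by fun_prop) continuous_const)
  obtain ⟨a, ⟨ha, ha1⟩, hmin⟩ := hcomp.exists_isMinOn
    ⟨1, ⟨fun _ => zero_le_one, fun _ => hM1⟩, by simp⟩ hcont.continuousOn
  have ha1' : ∏ i, a i = 1 := ha1
  refine ⟨a, fun i => lt_of_le_of_ne (ha.1 i) fun h0 => ?_, ha1, fun b hb hb1 => ?_⟩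
  · rw [Finset.prod_eq_zero (Finset.mem_univ i) h0.symm] at ha1'
    exact zero_ne_one ha1'
  · by_cases hbM : ∀ i, b i ≤ M
    · exact hmin ⟨⟨fun i => (hb i).le, hbM⟩, hb1⟩
    · push Not at hbM
      obtain ⟨i, hi⟩ := hbM
      have h1 : ‖L fun i => s i * a i ^ m‖ ≤ ‖L fun i => s i * (1 : Fin d → ℝ) i ^ m‖ :=
        hmin (show (1 : Fin d → ℝ) ∈ _ from ⟨⟨fun _ => zero_le_one, fun _ => hM1⟩, by simp⟩)
      rw [hLs] at h1
      refine h1.trans ?_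
      have h2 : C * ‖L s‖ ≤ C * ‖L fun i => s i * b i ^ m‖ :=
        calc C * ‖L s‖ ≤ M := le_max_right _ _
          _ ≤ b i := hi.le
          _ ≤ b i ^ m := le_self_pow₀ (hM1.trans hi.le) hm
          _ ≤ _ := hbound b hb i
      exact le_of_mul_le_mul_left h2 (NNReal.coe_pos.2 hC)

/-- The minimum of `‖L (lam_i a_i ^ m)‖` over the vectors `a` of positive coordinates of product `1`
is proportional to the geometric mean of the `|lam_i|`, as long as their signs do not change. Hence
it depends continuously on `lam`, and so does a suitable minimizer. -/
lemma exists_continuous_optimal_sides {F : Type*} [NormedAddCommGroup F] [NormedSpace ℝ F]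
    (hd : 1 ≤ d) {L : (Fin d → ℝ) →L[ℝ] F} (hL : Function.Injective L) {m : ℕ} (hm : m ≠ 0)
    {X : Type*} [TopologicalSpace X] {S : Set X} (hS : IsPreconnected S) {lam : X → Fin d → ℝ}
    (hlam : ContinuousOn lam S) (hne : ∀ x ∈ S, ∀ i, lam x i ≠ 0) :
    ∃ a : X → Fin d → ℝ, ContinuousOn a S ∧ ∃ K : X → ℝ, ContinuousOn K S ∧ ∀ x ∈ S,
      (∀ i, 0 < a x i) ∧ ∏ i, a x i = 1 ∧ 0 < K x ∧ ‖L fun i => lam x i * a x i ^ m‖ = K x ∧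
      ∀ b : Fin d → ℝ, (∀ i, 0 < b i) → ∏ i, b i = 1 → K x ≤ ‖L fun i => lam x i * b i ^ m‖ := by
  rcases S.eq_empty_or_nonempty with rfl | ⟨x₀, hx₀⟩
  · exact ⟨fun _ _ => 0, continuousOn_empty _, fun _ => 0, continuousOn_empty _, by simp⟩
  have hd0 : (d : ℝ) ≠ 0 := by exact_mod_cast (by omega : d ≠ 0)
  have hm0 : (m : ℝ) ≠ 0 := by exact_mod_cast hm
  set s : Fin d → ℝ := fun i => SignType.sign (lam x₀ i) with hs
  have hs1 : ∀ i, |s i| = 1 := fun i => by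
    rcases lt_or_gt_of_ne (hne x₀ hx₀ i) with h | h <;> simp [hs, h]
  have hlami : ∀ i, ContinuousOn (fun x => lam x i) S := fun i =>
    (continuous_apply i).comp_continuousOn hlam
  have hsign : ∀ x ∈ S, ∀ i, lam x i = s i * |lam x i| := by
    intro x hx i
    have h0 : (0 : ℝ) ∉ (fun x => lam x i) '' S := fun ⟨y, hy, h⟩ => hne y hy i h
    rcases lt_or_gt_of_ne (hne x₀ hx₀ i) with h | h <;>
      rcases lt_or_gt_of_ne (hne x hx i) with h' | h'
    · simp [hs, h, abs_of_neg h']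
    · exact absurd (hS.intermediate_value hx₀ hx (hlami i) ⟨h.le, h'.le⟩) h0
    · exact absurd (hS.intermediate_value hx hx₀ (hlami i) ⟨h'.le, h.le⟩) h0
    · simp [hs, h, abs_of_pos h']
  obtain ⟨a₀, ha₀, ha₀1, hmin⟩ := exists_optimal_sides hL hm s hs1
  set κ := ‖L fun i => s i * a₀ i ^ m‖ with hκ
  have hκ0 : 0 < κ := by
    refine norm_pos_iff.2 fun h0 => ?_
    have h1 := congrFun (hL (h0.trans (map_zero L).symm)) ⟨0, hd⟩
    have h2 := hs1 ⟨0, hd⟩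
    rcases mul_eq_zero.1 h1 with h | h
    · rw [h, abs_zero] at h2
      exact zero_ne_one h2
    · exact (pow_pos (ha₀ _) m).ne' h
  set G : X → ℝ := fun x => ∏ i, |lam x i| ^ (1 / (d : ℝ)) with hG
  set r : X → Fin d → ℝ := fun x i => (G x / |lam x i|) ^ (1 / (m : ℝ)) with hr
  have habs : ∀ x ∈ S, ∀ i, 0 < |lam x i| := fun x hx i => abs_pos.2 (hne x hx i)
  have hG0 : ∀ x ∈ S, 0 < G x := fun x hx =>
    Finset.prod_pos fun i _ => Real.rpow_pos_of_pos (habs x hx i) _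
  have hr0 : ∀ x ∈ S, ∀ i, 0 < r x i := fun x hx i =>
    Real.rpow_pos_of_pos (div_pos (hG0 x hx) (habs x hx i)) _
  have hGd : ∀ x ∈ S, G x ^ d = ∏ i, |lam x i| := fun x hx => by
    rw [hG, ← Finset.prod_pow]
    refine Finset.prod_congr rfl fun i _ => ?_
    rw [← Real.rpow_natCast, ← Real.rpow_mul (habs x hx i).le, one_div_mul_cancel hd0,
      Real.rpow_one]
  have hr1 : ∀ x ∈ S, ∏ i, r x i = 1 := fun x hx => by
    simp only [hr]
    rw [Real.finsetProd_rpow _ _ fun i _ => (div_pos (hG0 x hx) (habs x hx i)).le,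
      Finset.prod_div_distrib, ← hGd x hx]
    simp [(pow_pos (hG0 x hx) d).ne']
  have hrm : ∀ x ∈ S, ∀ i, lam x i * r x i ^ m = G x * s i := fun x hx i => by
    have h1 : r x i ^ m = G x / |lam x i| := by
      rw [hr, ← Real.rpow_natCast, ← Real.rpow_mul (div_pos (hG0 x hx) (habs x hx i)).le,
        one_div_mul_cancel hm0, Real.rpow_one]
    rw [h1, hsign x hx i, abs_mul, hs1, abs_abs, one_mul]
    field_simp [(habs x hx i).ne']
  have hnorm : ∀ x ∈ S, ∀ b : Fin d → ℝ, ‖L fun i => lam x i * (r x i * b i) ^ m‖ =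
      G x * ‖L fun i => s i * b i ^ m‖ := fun x hx b => by
    have h1 : (fun i => lam x i * (r x i * b i) ^ m) = G x • fun i => s i * b i ^ m := by
      ext i
      rw [mul_pow, ← mul_assoc, hrm x hx, Pi.smul_apply, smul_eq_mul, mul_assoc]
    rw [h1, map_smul, norm_smul, Real.norm_of_nonneg (hG0 x hx).le]
  have hGc : ContinuousOn G S := continuousOn_finsetProd _ fun i _ =>
    (hlami i).abs.rpow_const fun x hx => Or.inl (habs x hx i).ne'
  refine ⟨fun x i => r x i * a₀ i, ?_, fun x => G x * κ, hGc.mul continuousOn_const,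
    fun x hx => ⟨fun i => mul_pos (hr0 x hx i) (ha₀ i), ?_, mul_pos (hG0 x hx) hκ0,
      hnorm x hx a₀, fun b hb hb1 => ?_⟩⟩
  · refine continuousOn_pi.2 fun i => ContinuousOn.mul ?_ continuousOn_const
    exact (hGc.div (hlami i).abs fun x hx => (habs x hx i).ne').rpow_const
      fun x hx => Or.inl (div_pos (hG0 x hx) (habs x hx i)).ne'
  · rw [Finset.prod_mul_distrib, hr1 x hx, ha₀1, one_mul]
  · have h1 := hnorm x hx fun i => b i / r x i
    simp only [mul_div_cancel₀ _ (hr0 x hx _).ne'] at h1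
    rw [h1]
    refine mul_le_mul_of_nonneg_left (hmin _ (fun i => div_pos (hb i) (hr0 x hx i)) ?_)
      (hG0 x hx).le
    rw [Finset.prod_div_distrib, hb1, hr1 x hx, div_one]

/-! ### Tilings by nearly optimal blocks -/

/-- The numbers of pieces into which the sides of `Q` are cut so as to obtain blocks with side
lengths at most, and close to, `h * s i`. -/
noncomputable def tileCount (Q : Block d) (s : Fin d → ℝ) (h : ℝ) (i : Fin d) : ℕ :=
  ⌈Q.side i / s i * h⁻¹⌉₊

lemma tileCount_pos (Q : Block d) {s : Fin d → ℝ} (hs : ∀ i, 0 < s i) {h : ℝ} (hh : 0 < h)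
    (i : Fin d) : 0 < tileCount Q s h i :=
  Nat.ceil_pos.2 (mul_pos (div_pos (Q.side_pos i) (hs i)) (inv_pos.2 hh))

lemma tendsto_mul_tileCount (Q : Block d) {s : Fin d → ℝ} (hs : ∀ i, 0 < s i) (i : Fin d) :
    Tendsto (fun h : ℝ => h * tileCount Q s h i) (nhdsWithin 0 (Set.Ioi 0))
      (nhds (Q.side i / s i)) := by
  have h1 := (tendsto_nat_ceil_mul_div_atTop (div_pos (Q.side_pos i) (hs i)).le).comp
    (tendsto_inv_nhdsGT_zero (𝕜 := ℝ))
  refine h1.congr fun h => ?_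
  simp only [Function.comp, tileCount, div_inv_eq_mul]
  rw [mul_comm]

lemma tendsto_pow_mul_prod_tileCount (Q : Block d) {s : Fin d → ℝ} (hs : ∀ i, 0 < s i) :
    Tendsto (fun h : ℝ => h ^ d * ∏ i, (tileCount Q s h i : ℝ)) (nhdsWithin 0 (Set.Ioi 0))
      (nhds ((∏ i, Q.side i) * (∏ i, s i)⁻¹)) := by
  have h1 := tendsto_finsetProd Finset.univ fun i _ => tendsto_mul_tileCount Q hs i
  rw [Finset.prod_div_distrib, div_eq_mul_inv] at h1
  refine h1.congr fun h => ?_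
  rw [Finset.prod_mul_distrib, Finset.prod_const, Finset.card_univ, Fintype.card_fin]

lemma side_le_of_mem_tiling {Q R : Block d} {s : Fin d → ℝ} (hs : ∀ i, 0 < s i) {h : ℝ}
    (hh : 0 < h) (hR : R ∈ Q.subdivide (tileCount Q s h)) (i : Fin d) : R.side i ≤ h * s i := by
  have hn : (0 : ℝ) < tileCount Q s h i := Nat.cast_pos.2 (tileCount_pos Q hs hh i)
  rw [Block.side_of_mem_subdivide hR, div_le_iff₀ hn]
  have h1 : Q.side i / s i * h⁻¹ ≤ tileCount Q s h i := Nat.le_ceil _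
  have h2 := mul_le_mul_of_nonneg_left h1 (mul_pos hh (hs i)).le
  have h3 : h * s i * (Q.side i / s i * h⁻¹) = Q.side i := by
    field_simp [hh.ne', (hs i).ne']
  linarith

/-- As the scale `h` tends to `0`, the blocks of the tiling take the prescribed shape. -/
lemma eventually_tile_error_le {F : Type*} [NormedAddCommGroup F] [NormedSpace ℝ F]
    (L : (Fin d → ℝ) →L[ℝ] F) (Q : Block d) {s : Fin d → ℝ} (hs : ∀ i, 0 < s i)
    (lam : Fin d → ℝ) (m : ℕ) (q : ℝ)
    (hle : (∏ i, s i) ^ q * ‖L fun i => lam i * s i ^ m‖ ≤ 1) {δ : ℝ} (hδ : 0 < δ) :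
    ∀ᶠ h in nhdsWithin (0 : ℝ) (Set.Ioi 0), ∀ R ∈ Q.subdivide (tileCount Q s h),
      (∏ i, R.side i) ^ q * ‖L fun i => lam i * R.side i ^ m‖ ≤ h ^ m * (h ^ d) ^ q * (1 + δ) := by
  set u : ℝ → Fin d → ℝ := fun h i => Q.side i / (h * tileCount Q s h i) with hu
  have hulim : Tendsto u (nhdsWithin 0 (Set.Ioi 0)) (nhds s) := by
    refine tendsto_pi_nhds.2 fun i => ?_
    have h1 := (tendsto_const_nhds (x := Q.side i)).div (tendsto_mul_tileCount Q hs i)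
      (div_pos (Q.side_pos i) (hs i)).ne'
    rwa [div_div_cancel₀ (Q.side_pos i).ne'] at h1
  have hcont : ContinuousAt (fun v : Fin d → ℝ =>
      (∏ i, v i) ^ q * ‖L fun i => lam i * v i ^ m‖) s := by
    refine ContinuousAt.mul (ContinuousAt.rpow_const ?_ (Or.inl ?_)) ?_
    · exact (continuous_finsetProd _ fun i _ => continuous_apply i).continuousAt
    · exact (Finset.prod_pos fun i _ => hs i).ne'
    · exact (L.continuous.comp (by fun_prop)).norm.continuousAt
  filter_upwards [(hcont.tendsto.comp hulim).eventually (gt_mem_nhds (hle.trans_lt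
    (lt_add_of_pos_right 1 hδ))), self_mem_nhdsWithin] with h hlt hh R hR
  have hh0 : 0 < h := hh
  have hside : ∀ i, R.side i = h * u h i := fun i => by
    have hn : (0 : ℝ) < tileCount Q s h i := Nat.cast_pos.2 (tileCount_pos Q hs hh i)
    rw [Block.side_of_mem_subdivide hR]
    simp only [hu]
    field_simp
  have hu0 : ∀ i, 0 < u h i := fun i => by
    have := R.side_pos i
    rw [hside] at this
    exact pos_of_mul_pos_right this hh0.le
  have h1 : (fun i => lam i * R.side i ^ m) = h ^ m • fun i => lam i * u h i ^ m := by
    ext i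
    rw [hside, mul_pow, Pi.smul_apply, smul_eq_mul]
    ring
  have h2 : ∏ i, R.side i = h ^ d * ∏ i, u h i := by
    simp only [hside]
    rw [Finset.prod_mul_distrib, Finset.prod_const, Finset.card_univ, Fintype.card_fin]
  rw [h1, h2, map_smul, norm_smul, Real.norm_of_nonneg (pow_nonneg hh0.le _),
    Real.mul_rpow (pow_nonneg hh0.le _) (Finset.prod_nonneg fun i _ => (hu0 i).le)]
  calc _ = h ^ m * (h ^ d) ^ q * ((∏ i, u h i) ^ q * ‖L fun i => lam i * u h i ^ m‖) := by ring
    _ ≤ _ := mul_le_mul_of_nonneg_left hlt.le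
      (mul_nonneg (pow_nonneg hh0.le _) (Real.rpow_nonneg (pow_nonneg hh0.le _) _))

lemma interpPartition_eq (I : V d →L[ℝ] V d) {R₀ : Block d} {P : Finset (Block d)}
    (hP : IsBlockPartition R₀ P) (f : (Fin d → ℝ) → ℝ) {R : Block d} (hR : R ∈ P)
    {x : Fin d → ℝ} (hx : x ∈ interior R.toSet) :
    interpPartition I P f x = interpBlock I R f x := by
  rw [interpPartition, Finset.sum_eq_single R, Set.indicator_of_mem hx]
  · intro R' hR' hne
    refine Set.indicator_of_notMem (fun hx' => ?_) _
    have hpos : 0 < volume (interior R'.toSet ∩ interior R.toSet) :=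
      (isOpen_interior.inter isOpen_interior).measure_pos volume ⟨x, hx', hx⟩
    exact hpos.ne' (measure_mono_null (Set.inter_subset_inter interior_subset interior_subset)
      (hP.null_inter R' hR' R hR hne))
  · exact fun h => absurd hR h

/-- The global interpolation error on a partition all of whose local errors are at most `B`. -/
lemma eLpNorm_interpPartition_le (I : V d →L[ℝ] V d) {p : ℝ≥0∞} (hp : 1 ≤ p) {R₀ : Block d}
    {P : Finset (Block d)} (hP : IsBlockPartition R₀ P) (f : (Fin d → ℝ) → ℝ) {N : ℕ}
    (hN : P.card ≤ N) {B : ℝ≥0∞} (hB : ∀ R ∈ P,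
      eLpNorm (fun x => f x - interpBlock I R f x) p (volume.restrict R.toSet) ≤ B) :
    eLpNorm (fun x => f x - interpPartition I P f x) p (volume.restrict R₀.toSet) ≤
      (N : ℝ≥0∞) ^ (1 / p).toReal * B := by
  rw [← hP.union_eq]
  refine eLpNorm_biUnion_le hp P _ hN fun R hR => ?_
  refine (le_of_eq (eLpNorm_congr_ae ?_)).trans (hB R hR)
  filter_upwards [R.ae_mem_interior] with x hx
  rw [interpPartition_eq I hP f hR hx]

/-- The tilings adapted to a field `s` of block shapes, at a small scale `h`. The field is
normalized so that the scale `h` produces a local error of about `h ^ (m + d / p)` everywhere, and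
`h ^ (-d) / ∏ s i` is the local density of blocks. -/
lemma eventually_exists_tiling {I : V d →L[ℝ] V d} (hI : ∀ g : V d, I (I g) = I g) {k : ℕ}
    (hS : HStar I k) (p : ℝ≥0∞) [Fact (1 ≤ p)] {R₀ : Block d}
    {f : (Fin d → ℝ) → ℝ} (hf : ContDiffOn ℝ (k + 1 : ℕ) f R₀.toSet)
    {s : (Fin d → ℝ) → Fin d → ℝ} (hsc : ContinuousOn s R₀.toSet)
    (hs : ∀ x ∈ R₀.toSet, ∀ i, 0 < s x i) {A : ℝ} (hA : ∀ x ∈ R₀.toSet, ∀ i, s x i ≤ A)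
    (hnorm : ∀ x ∈ R₀.toSet, (∏ i, s x i) ^ (1 / p).toReal *
      ‖pureErrLp I p (k + 1) fun i => pureCoeff (k + 1) f R₀.toSet x i * s x i ^ (k + 1)‖ ≤ 1)
    {J : ℝ} (hJ : ∫⁻ x in R₀.toSet, ENNReal.ofReal (∏ i, s x i)⁻¹ ≤ ENNReal.ofReal J)
    (hJ0 : 0 ≤ J) (hA0 : 0 ≤ A) {ε : ℝ} (hε : 0 < ε) :
    ∀ᶠ h in nhdsWithin (0 : ℝ) (Set.Ioi 0), ∃ P, IsBlockPartition R₀ P ∧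
      h ^ d * P.card ≤ J + ε ∧ (∀ R ∈ P, ∀ i, R.side i ≤ h * A) ∧
      ∀ R ∈ P, eLpNorm (fun x => f x - interpBlock I R f x) p (volume.restrict R.toSet) ≤
        ENNReal.ofReal (h ^ (k + 1) * (h ^ d) ^ (1 / p).toReal * (1 + ε)) := by
  classical
  set q : ℝ := (1 / p).toReal with hq
  have hq0 : 0 ≤ q := ENNReal.toReal_nonneg
  set C : ℝ := ‖toLpV d p‖ * (1 + ‖I‖) with hC
  have hC0 : 0 ≤ C := by positivity
  set W : ℝ := C * A ^ (k + 1) * (A ^ d) ^ q with hW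
  have hW0 : 0 ≤ W := by positivity
  -- The contribution of the oscillation of `d^m f` on a cell is at most `W * ω ≤ ε / 2`.
  set ω : ℝ := ε / 2 / (W + 1) with hω
  have hω0 : 0 < ω := by positivity
  have hWω : W * ω ≤ ε / 2 := by
    rw [hω, mul_div_assoc', div_le_iff₀ (by positivity)]
    nlinarith
  obtain ⟨δ, hδ, hosc⟩ := Metric.uniformContinuousOn_iff.1
    (R₀.isCompact_toSet.uniformContinuousOn_of_continuous
      (hf.continuousOn_iteratedFDerivWithin le_rfl R₀.uniqueDiffOn_toSet)) ω hω0
  obtain ⟨P₀, hP₀, hdiam⟩ := exists_partition_diam_lt R₀ hδ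
  -- In each cell, `z` is a point where the density of blocks is smallest.
  have hz : ∀ Q : Block d, ∃ z, Q ∈ P₀ → z ∈ Q.toSet ∧ ∀ x ∈ Q.toSet, ∏ i, s x i ≤ ∏ i, s z i := by
    intro Q
    by_cases hQ : Q ∈ P₀
    · obtain ⟨z, hz, hmax⟩ := Q.isCompact_toSet.exists_isMaxOn ⟨_, Q.lo_mem⟩
        (f := fun x => ∏ i, s x i) (continuousOn_finsetProd _ fun i _ =>
          (continuous_apply i).comp_continuousOn (hsc.mono (hP₀.subset hQ)))
      exact ⟨z, fun _ => ⟨hz, fun x hx => hmax hx⟩⟩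
    · exact ⟨0, fun h => absurd h hQ⟩
  choose z hz using hz
  have hz0 : ∀ Q ∈ P₀, z Q ∈ R₀.toSet := fun Q hQ => hP₀.subset hQ (hz Q hQ).1
  have hcount : ∑ Q ∈ P₀, (∏ i, Q.side i) * (∏ i, s (z Q) i)⁻¹ ≤ J := by
    have hterm : ∀ Q ∈ P₀, 0 ≤ (∏ i, Q.side i) * (∏ i, s (z Q) i)⁻¹ := fun Q hQ =>
      mul_nonneg Q.prod_side_pos.le (inv_nonneg.2 (Finset.prod_nonneg fun i _ =>
        (hs _ (hz0 Q hQ) i).le))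
    rw [← ENNReal.ofReal_le_ofReal_iff hJ0, ENNReal.ofReal_sum_of_nonneg hterm]
    refine le_trans ?_ hJ
    rw [hP₀.lintegral_eq]
    refine Finset.sum_le_sum fun Q hQ => ?_
    rw [ENNReal.ofReal_mul Q.prod_side_pos.le, ← Q.volume_toSet, mul_comm, ← setLIntegral_const]
    refine setLIntegral_mono' Q.measurableSet_toSet fun x hx => ENNReal.ofReal_le_ofReal ?_
    exact inv_anti₀ (Finset.prod_pos fun i _ => hs x (hP₀.subset hQ hx) i) ((hz Q hQ).2 x hx)
  have hev1 : ∀ᶠ h in nhdsWithin (0 : ℝ) (Set.Ioi 0),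
      ∑ Q ∈ P₀, h ^ d * ∏ i, (tileCount Q (s (z Q)) h i : ℝ) < J + ε :=
    (tendsto_finsetSum P₀ fun Q hQ => tendsto_pow_mul_prod_tileCount Q
      (hs _ (hz0 Q hQ))).eventually (gt_mem_nhds (by linarith))
  have hev2 : ∀ᶠ h in nhdsWithin (0 : ℝ) (Set.Ioi 0), ∀ Q ∈ P₀,
      ∀ R ∈ Q.subdivide (tileCount Q (s (z Q)) h), (∏ i, R.side i) ^ q *
        ‖pureErrLp I p (k + 1) fun i => pureCoeff (k + 1) f R₀.toSet (z Q) i *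
          R.side i ^ (k + 1)‖ ≤ h ^ (k + 1) * (h ^ d) ^ q * (1 + ε / 2) :=
    (eventually_all_finset P₀).2 fun Q hQ => eventually_tile_error_le _ Q (hs _ (hz0 Q hQ)) _ _ q
      (hnorm _ (hz0 Q hQ)) (half_pos hε)
  filter_upwards [hev1, hev2, self_mem_nhdsWithin] with h h1 h2 hh
  have hh0 : 0 < h := hh
  have hside : ∀ Q ∈ P₀, ∀ R ∈ Q.subdivide (tileCount Q (s (z Q)) h), ∀ i, R.side i ≤ h * A :=
    fun Q hQ R hR i => (side_le_of_mem_tiling (hs _ (hz0 Q hQ)) hh0 hR i).trans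
      (mul_le_mul_of_nonneg_left (hA _ (hz0 Q hQ) i) hh0.le)
  have hsub : ∀ Q ∈ P₀, IsBlockPartition Q (Q.subdivide (tileCount Q (s (z Q)) h)) :=
    fun Q hQ => Q.isBlockPartition_subdivide (tileCount_pos Q (hs _ (hz0 Q hQ)) hh0)
  refine ⟨P₀.biUnion fun Q => Q.subdivide (tileCount Q (s (z Q)) h), hP₀.biUnion hsub, ?_, ?_, ?_⟩
  · refine le_trans ?_ h1.le
    rw [← Finset.mul_sum]
    refine mul_le_mul_of_nonneg_left ?_ (pow_nonneg hh0.le _)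
    calc ((P₀.biUnion fun Q => Q.subdivide (tileCount Q (s (z Q)) h)).card : ℝ)
        ≤ ((∑ Q ∈ P₀, ∏ i, tileCount Q (s (z Q)) h i : ℕ) : ℝ) :=
          Nat.cast_le.2 (Finset.card_biUnion_le.trans
            (Finset.sum_le_sum fun Q _ => Q.card_subdivide_le _))
      _ = _ := by push_cast; rfl
  · intro R hR
    obtain ⟨Q, hQ, hRQ⟩ := Finset.mem_biUnion.1 hR
    exact hside Q hQ R hRQ
  · intro R hR
    obtain ⟨Q, hQ, hRQ⟩ := Finset.mem_biUnion.1 hR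
    have hRsub := (hsub Q hQ).subset hRQ
    refine (eLpNorm_interp_error_le hI hS p (hRsub.trans (hP₀.subset hQ)) hf (z Q) (ω := ω)
      (fun y hy => ?_) (mul_nonneg hh0.le hA0) (hside Q hQ R hRQ)).trans
      (ENNReal.ofReal_le_ofReal ?_)
    · rw [← dist_eq_norm]
      exact (hosc y (hP₀.subset hQ (hRsub hy)) _ (hz0 Q hQ)
        (hdiam Q hQ y (hRsub hy) _ (hz Q hQ).1)).le
    · have h3 : (∏ i, R.side i) ^ q ≤ (h ^ d) ^ q * (A ^ d) ^ q := by
        rw [← Real.mul_rpow (pow_nonneg hh0.le _) (pow_nonneg hA0 _), ← mul_pow]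
        refine Real.rpow_le_rpow R.prod_side_pos.le ?_ hq0
        calc ∏ i, R.side i ≤ ∏ _i : Fin d, h * A :=
              Finset.prod_le_prod (fun i _ => (R.side_pos i).le) fun i _ => hside Q hQ R hRQ i
          _ = (h * A) ^ d := by simp
      have h4 : (∏ i, R.side i) ^ q * (C * (ω * (h * A) ^ (k + 1))) ≤
          h ^ (k + 1) * (h ^ d) ^ q * (ε / 2) :=
        calc _ ≤ (h ^ d) ^ q * (A ^ d) ^ q * (C * (ω * (h * A) ^ (k + 1))) := by gcongr
          _ = h ^ (k + 1) * (h ^ d) ^ q * (W * ω) := by rw [hW, mul_pow]; ring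
          _ ≤ _ := by gcongr
      have h5 := h2 Q hQ R hRQ
      rw [mul_add]
      calc _ ≤ h ^ (k + 1) * (h ^ d) ^ q * (1 + ε / 2) + h ^ (k + 1) * (h ^ d) ^ q * (ε / 2) :=
            add_le_add h5 h4
        _ = _ := by ring

/-- The tilings adapted to a field `s` of block shapes, for a given number of blocks. -/
lemma eventually_exists_partition (hd : 1 ≤ d) {I : V d →L[ℝ] V d}
    (hI : ∀ g : V d, I (I g) = I g) {k : ℕ}
    (hS : HStar I k) (p : ℝ≥0∞) [Fact (1 ≤ p)] {R₀ : Block d}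
    {f : (Fin d → ℝ) → ℝ} (hf : ContDiffOn ℝ (k + 1 : ℕ) f R₀.toSet)
    {s : (Fin d → ℝ) → Fin d → ℝ} (hsc : ContinuousOn s R₀.toSet)
    (hs : ∀ x ∈ R₀.toSet, ∀ i, 0 < s x i) {A : ℝ} (hA : ∀ x ∈ R₀.toSet, ∀ i, s x i ≤ A)
    (hnorm : ∀ x ∈ R₀.toSet, (∏ i, s x i) ^ (1 / p).toReal *
      ‖pureErrLp I p (k + 1) fun i => pureCoeff (k + 1) f R₀.toSet x i * s x i ^ (k + 1)‖ ≤ 1)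
    {J : ℝ} (hJ : ∫⁻ x in R₀.toSet, ENNReal.ofReal (∏ i, s x i)⁻¹ ≤ ENNReal.ofReal J)
    (hJ0 : 0 ≤ J) (hA0 : 0 ≤ A) {ε : ℝ} (hε : 0 < ε) :
    ∀ᶠ N : ℕ in atTop, ∃ P, IsBlockPartition R₀ P ∧ P.card ≤ N ∧
      (∀ R ∈ P, (N : ℝ) ^ (1 / (d : ℝ)) * R.diam ≤ Real.sqrt d * A * (J + ε) ^ (1 / (d : ℝ))) ∧
      (N : ℝ≥0∞) ^ (((k + 1 : ℕ) : ℝ) / (d : ℝ)) *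
        eLpNorm (fun x => f x - interpPartition I P f x) p (volume.restrict R₀.toSet) ≤
        ENNReal.ofReal ((J + ε) ^ (((k + 1 : ℕ) : ℝ) / d + (1 / p).toReal) * (1 + ε)) := by
  have hd0 : (0 : ℝ) < d := by exact_mod_cast hd
  have hJε : 0 < J + ε := by linarith
  set q : ℝ := (1 / p).toReal with hq
  have hq0 : 0 ≤ q := ENNReal.toReal_nonneg
  have hlim : Tendsto (fun N : ℕ => ((J + ε) / (N : ℝ)) ^ (1 / (d : ℝ))) atTop
      (nhdsWithin 0 (Set.Ioi 0)) := by
    refine tendsto_nhdsWithin_iff.2 ⟨?_, ?_⟩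
    · have h1 := (tendsto_const_div_atTop_nhds_zero_nat (J + ε)).rpow_const
        (p := 1 / (d : ℝ)) (Or.inr (by positivity))
      rwa [Real.zero_rpow (by positivity)] at h1
    · filter_upwards [eventually_gt_atTop 0] with N hN
      have : (0 : ℝ) < N := by exact_mod_cast hN
      exact Real.rpow_pos_of_pos (by positivity) _
  filter_upwards [hlim.eventually
    (eventually_exists_tiling hI hS p hf hsc hs hA hnorm hJ hJ0 hA0 hε), eventually_gt_atTop 0]
    with N ⟨P, hP, hcard, hside, herr⟩ hN
  have hN0 : (0 : ℝ) < N := by exact_mod_cast hN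
  set h : ℝ := ((J + ε) / (N : ℝ)) ^ (1 / (d : ℝ)) with hh
  have hh0 : 0 < h := Real.rpow_pos_of_pos (by positivity) _
  have hhd : h ^ d = (J + ε) / N := by
    rw [hh, ← Real.rpow_natCast, ← Real.rpow_mul (by positivity), one_div_mul_cancel hd0.ne',
      Real.rpow_one]
  have hNh : (N : ℝ) ^ (1 / (d : ℝ)) * h = (J + ε) ^ (1 / (d : ℝ)) := by
    rw [hh, ← Real.mul_rpow hN0.le (by positivity), mul_div_cancel₀ _ hN0.ne']
  have hcard' : P.card ≤ N := by
    rw [hhd, div_mul_eq_mul_div, div_le_iff₀ hN0] at hcard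
    exact_mod_cast le_of_mul_le_mul_left hcard hJε
  refine ⟨P, hP, hcard', fun R hR => ?_, ?_⟩
  · calc (N : ℝ) ^ (1 / (d : ℝ)) * R.diam ≤ (N : ℝ) ^ (1 / (d : ℝ)) * (Real.sqrt d * (h * A)) := by
          gcongr
          exact R.diam_le (hside R hR)
      _ = Real.sqrt d * A * ((N : ℝ) ^ (1 / (d : ℝ)) * h) := by ring
      _ = _ := by rw [hNh]
  · have hle := eLpNorm_interpPartition_le I Fact.out hP f hcard' herr
    refine (mul_le_mul_right hle _).trans (le_of_eq ?_)
    have hNr : (N : ℝ≥0∞) = ENNReal.ofReal N := (ENNReal.ofReal_natCast N).symm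
    rw [hNr, ENNReal.ofReal_rpow_of_pos hN0, ENNReal.ofReal_rpow_of_pos hN0,
      ← ENNReal.ofReal_mul (by positivity), ← ENNReal.ofReal_mul (by positivity)]
    congr 1
    have h1 : (N : ℝ) ^ (((k + 1 : ℕ) : ℝ) / d) * h ^ (k + 1) =
        (J + ε) ^ (((k + 1 : ℕ) : ℝ) / d) := by
      have h2 : ∀ y : ℝ, 0 ≤ y → y ^ (((k + 1 : ℕ) : ℝ) / d) = (y ^ (1 / (d : ℝ))) ^ (k + 1) :=
        fun y hy => by
          rw [← Real.rpow_natCast, ← Real.rpow_mul hy, one_div_mul_eq_div]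
      rw [h2 _ hN0.le, h2 _ hJε.le, ← mul_pow, hNh]
    have h3 : (N : ℝ) ^ q * (h ^ d) ^ q = (J + ε) ^ q := by
      rw [← Real.mul_rpow hN0.le (by positivity), hhd, mul_div_cancel₀ _ hN0.ne']
    rw [Real.rpow_add hJε, ← h1, ← h3]
    ring

/-! ### Optimal shapes and admissible sequences -/

lemma continuousOn_pureCoeff {m : ℕ} {f : (Fin d → ℝ) → ℝ} {R₀ : Block d}
    (hf : ContDiffOn ℝ m f R₀.toSet) : ContinuousOn (pureCoeff m f R₀.toSet) R₀.toSet := by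
  refine continuousOn_pi.2 fun i => ContinuousOn.div_const ?_ _
  exact (ContinuousMultilinearMap.apply ℝ (fun _ : Fin m => Fin d → ℝ) ℝ
    fun _ => Pi.single i 1).continuous.comp_continuousOn
      (hf.continuousOn_iteratedFDerivWithin le_rfl R₀.uniqueDiffOn_toSet)

/-- Where the error function of `d^m f` does not vanish, it is continuous, and optimal blocks can be
chosen continuously. -/
lemma exists_optimal_shapes (hd : 1 ≤ d) {I : V d →L[ℝ] V d} (hI : ∀ g : V d, I (I g) = I g)
    {k : ℕ} (hS : HStar I k) (p : ℝ≥0∞) [Fact (1 ≤ p)]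
    (hyp : (Odd (k + 1) ∧ HSign I) ∨ HStarStar I (k + 1)) {R₀ : Block d} {f : (Fin d → ℝ) → ℝ}
    (hf : ContDiffOn ℝ (k + 1 : ℕ) f R₀.toSet)
    (hpos : ∀ x ∈ R₀.toSet, 0 < errorFun I p (taylorHom (k + 1) f R₀.toSet x)) :
    ∃ a : (Fin d → ℝ) → Fin d → ℝ, ContinuousOn a R₀.toSet ∧
      ∃ K : (Fin d → ℝ) → ℝ, ContinuousOn K R₀.toSet ∧ ∀ x ∈ R₀.toSet,
      (∀ i, 0 < a x i) ∧ ∏ i, a x i = 1 ∧ 0 < K x ∧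
      ‖pureErrLp I p (k + 1) fun i => pureCoeff (k + 1) f R₀.toSet x i * a x i ^ (k + 1)‖ = K x ∧
      errorFun I p (taylorHom (k + 1) f R₀.toSet x) = ENNReal.ofReal (K x) := by
  have hne : ∀ x ∈ R₀.toSet, ∀ i, pureCoeff (k + 1) f R₀.toSet x i • toLpV d p
      (polyV (MvPolynomial.X i ^ (k + 1)) - I (polyV (MvPolynomial.X i ^ (k + 1)))) ≠ 0 :=
    fun x hx i h => (hpos x hx).ne' (errorFun_eq_zero hI hS f R₀.toSet x i h)
  have hinj : Function.Injective (pureErrLp I p (k + 1)) := by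
    refine (toLpV_injective p).comp ?_
    rcases hyp with ⟨hodd, hsign⟩ | h
    · refine pureErr_injective_of_odd hodd hsign fun i h => hne _ R₀.lo_mem i ?_
      rw [h, map_zero, smul_zero]
    · exact pureErr_injective_of_hStarStar h
  obtain ⟨a, ha, K, hK, h⟩ := exists_continuous_optimal_sides hd hinj (Nat.succ_ne_zero k)
    R₀.convex_toSet.isPreconnected (continuousOn_pureCoeff hf) fun x hx i h0 =>
      hne x hx i (by rw [h0, zero_smul])
  refine ⟨a, ha, K, hK, fun x hx => ?_⟩
  obtain ⟨h1, h2, h3, h4, h5⟩ := h x hx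
  refine ⟨h1, h2, h3, h4, le_antisymm ?_ (le_errorFun hI hS f _ x h5)⟩
  rw [← h4]
  exact errorFun_le hI hS f _ x h1 h2

lemma exists_near_minimizer {α : Type*} {S : Set α} (hS : S.Nonempty) (F : α → ℝ≥0∞) {δ : ℝ≥0∞}
    (hδ : δ ≠ 0) : ∃ a ∈ S, ∀ b ∈ S, F a ≤ F b + δ := by
  by_cases h : ⨅ b ∈ S, F b = ⊤
  · obtain ⟨a, ha⟩ := hS
    refine ⟨a, ha, fun b hb => ?_⟩
    rw [iInf₂_eq_top.1 h b hb]
    simp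
  · have hlt := ENNReal.lt_add_right h hδ
    simp only [iInf_lt_iff] at hlt
    obtain ⟨a, ha, hlt⟩ := hlt
    exact ⟨a, ha, fun b hb => hlt.le.trans (add_le_add_left (iInf₂_le b hb) _)⟩

lemma tau_toReal {m d : ℕ} (hd : 1 ≤ d) {p : ℝ≥0∞} (hp : 1 ≤ p) :
    (tau m d p).toReal = ((m : ℝ) / d + (1 / p).toReal)⁻¹ := by
  have hd0 : (d : ℝ≥0∞) ≠ 0 := by exact_mod_cast (by omega : d ≠ 0)
  have h1 : (m : ℝ≥0∞) / d ≠ ⊤ := ENNReal.div_ne_top (ENNReal.natCast_ne_top m) hd0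
  have h2 : p⁻¹ ≠ ⊤ := ENNReal.inv_ne_top.2 (zero_lt_one.trans_le hp).ne'
  rw [tau, ENNReal.toReal_inv, ENNReal.toReal_add h1 h2, ENNReal.toReal_div, one_div]
  simp

/-- Once good partitions exist for every tolerance `ε`, partitions which are nearly the best ones
form an admissible sequence that is good for all tolerances at once. -/
lemma exists_admissible (R₀ : Block d) (F : ℕ → Finset (Block d) → ℝ≥0∞) {C : ℝ} {g : ℝ → ℝ}
    (hg : ContinuousWithinAt g (Set.Ioi 0) 0)
    (h : ∀ ε, 0 < ε → ε ≤ 1 → ∀ᶠ N : ℕ in atTop, ∃ P, IsBlockPartition R₀ P ∧ P.card ≤ N ∧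
      (∀ R ∈ P, (N : ℝ) ^ (1 / (d : ℝ)) * R.diam ≤ C) ∧ F N P ≤ ENNReal.ofReal (g ε)) :
    ∃ P : ℕ → Finset (Block d), IsAdmissible R₀ P ∧
      limsup (fun N => F N (P N)) atTop ≤ ENNReal.ofReal (g 0) := by
  obtain ⟨N₁, hN₁⟩ := eventually_atTop.1 (h 1 one_pos le_rfl)
  set C' : ℝ := max C ((N₁ : ℝ) ^ (1 / (d : ℝ)) * R₀.diam) with hC'
  set S : ℕ → Set (Finset (Block d)) := fun N => {P | IsBlockPartition R₀ P ∧ P.card ≤ N ∧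
    ∀ R ∈ P, (N : ℝ) ^ (1 / (d : ℝ)) * R.diam ≤ C'} with hS
  have hne : ∀ N, 1 ≤ N → (S N).Nonempty := fun N hN => by
    rcases le_total N₁ N with hle | hle
    · obtain ⟨P, hP, hcard, hdiam, -⟩ := hN₁ N hle
      exact ⟨P, hP, hcard, fun R hR => (hdiam R hR).trans (le_max_left _ _)⟩
    · refine ⟨{R₀}, isBlockPartition_singleton R₀, by simpa using hN, fun R hR => ?_⟩
      rw [Finset.mem_singleton.1 hR]
      refine le_trans ?_ (le_max_right _ _)
      have : (N : ℝ) ≤ N₁ := by exact_mod_cast hle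
      have h0 : 0 ≤ R₀.diam := Real.sqrt_nonneg _
      gcongr
  have hδ : ∀ N : ℕ, ENNReal.ofReal (1 / ((N : ℝ) + 1)) ≠ 0 := fun N =>
    (ENNReal.ofReal_pos.2 (by positivity)).ne'
  have hex : ∀ N : ℕ, ∃ P, 1 ≤ N → P ∈ S N ∧ ∀ P' ∈ S N,
      F N P ≤ F N P' + ENNReal.ofReal (1 / ((N : ℝ) + 1)) := fun N => by
    by_cases hN : 1 ≤ N
    · obtain ⟨P, hP, hmin⟩ := exists_near_minimizer (hne N hN) (F N) (hδ N)
      exact ⟨P, fun _ => ⟨hP, hmin⟩⟩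
    · exact ⟨∅, fun h => absurd h hN⟩
  choose P hP using hex
  refine ⟨P, ⟨fun N hN => (hP N hN).1.1, fun N hN => (hP N hN).1.2.1,
    C', fun N hN => (hP N hN).1.2.2⟩, ?_⟩
  have hle : ∀ ε, 0 < ε → ε ≤ 1 → limsup (fun N => F N (P N)) atTop ≤
      ENNReal.ofReal (g ε) + ENNReal.ofReal ε := fun ε hε hε1 => by
    refine limsup_le_of_le (by isBoundedDefault) ?_
    filter_upwards [h ε hε hε1, eventually_ge_atTop 1,
      tendsto_one_div_add_atTop_nhds_zero_nat.eventually (gt_mem_nhds hε)]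
      with N ⟨P', hP', hcard, hdiam, hF⟩ hN hNε
    refine ((hP N hN).2 P' ⟨hP', hcard,
      fun R hR => (hdiam R hR).trans (le_max_left _ _)⟩).trans ?_
    exact add_le_add hF (ENNReal.ofReal_le_ofReal hNε.le)
  have hlim : Tendsto (fun ε => ENNReal.ofReal (g ε) + ENNReal.ofReal ε)
      (nhdsWithin 0 (Set.Ioi 0)) (nhds (ENNReal.ofReal (g 0))) := by
    have h1 := ((ENNReal.continuous_ofReal.tendsto (g 0)).comp hg).add
      ((ENNReal.continuous_ofReal.tendsto 0).mono_left (nhdsWithin_le_nhds (s := Set.Ioi 0)))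
    rw [ENNReal.ofReal_zero, add_zero] at h1
    exact h1
  refine ge_of_tendsto hlim ?_
  filter_upwards [self_mem_nhdsWithin, mem_nhdsWithin_of_mem_nhds (Iic_mem_nhds zero_lt_one)]
    with ε hε hε1 using hle ε hε hε1

end BlockInterp

open BlockInterp in
theorem theorem3 {d : ℕ} (hd : 1 ≤ d)
    (I : V d →L[ℝ] V d) (hI : ∀ g : V d, I (I g) = I g)
    (k : ℕ) (hk : IsReproductionDegree I k) (m : ℕ) (hm : m = k + 1)
    (p : ℝ≥0∞) (hp : 1 ≤ p)
    (hyp : (Odd m ∧ HSign I ∧ HPerm I ∧ HStar I k) ∨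
      (Even m ∧ HPerm I ∧ HStar I k ∧ HStarStar I m))
    (R₀ : Block d) (f : (Fin d → ℝ) → ℝ) (hf : ContDiffOn ℝ (m : WithTop ℕ∞) f R₀.toSet)
    (hpos : ∀ x ∈ R₀.toSet, 0 < errorFun I p (taylorHom m f R₀.toSet x)) :
    ∃ P : ℕ → Finset (Block d), IsAdmissible R₀ P ∧
      limsup (fun N : ℕ => (N : ℝ≥0∞) ^ ((m : ℝ) / (d : ℝ)) *
          eLpNorm (fun x => f x - interpPartition I (P N) f x) p (volume.restrict R₀.toSet)) atTop
        ≤ eLpNorm (fun x => errorFun I p (taylorHom m f R₀.toSet x)) (tau m d p)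
            (volume.restrict R₀.toSet) := by
  subst hm
  have : Fact (1 ≤ p) := ⟨hp⟩
  have hS : HStar I k := hyp.elim (fun h => h.2.2.2) fun h => h.2.2.1
  obtain ⟨a, hac, K, hKc, hK⟩ := exists_optimal_shapes hd hI hS p
    (hyp.imp (fun h => ⟨h.1, h.2.1⟩) fun h => h.2.2.2) hf hpos
  have hd0 : (0 : ℝ) < d := by exact_mod_cast hd
  set q : ℝ := (1 / p).toReal with hq
  have hq0 : 0 ≤ q := ENNReal.toReal_nonneg
  set σ : ℝ := ((k + 1 : ℕ) : ℝ) / d + q with hσ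
  have hσ0 : 0 < σ := by positivity
  have hτ : (tau (k + 1) d p).toReal = σ⁻¹ := tau_toReal hd hp
  have hτpos : 0 < (tau (k + 1) d p).toReal := hτ ▸ inv_pos.2 hσ0
  have hτ0 := ENNReal.toReal_pos_iff.1 hτpos
  -- A volume of the blocks inversely proportional to `K ^ τ` equidistributes the errors.
  set s : (Fin d → ℝ) → Fin d → ℝ := fun x i => a x i * K x ^ (-(σ⁻¹ / d)) with hs
  have hprod : ∀ x ∈ R₀.toSet, ∏ i, s x i = K x ^ (-σ⁻¹) := fun x hx => by
    obtain ⟨-, ha1, hK0, -, -⟩ := hK x hx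
    simp only [hs]
    rw [Finset.prod_mul_distrib, ha1, one_mul, Finset.prod_const, Finset.card_univ,
      Fintype.card_fin, ← Real.rpow_natCast, ← Real.rpow_mul hK0.le]
    congr 1
    field_simp
  have hs0 : ∀ x ∈ R₀.toSet, ∀ i, 0 < s x i := fun x hx i =>
    mul_pos ((hK x hx).1 i) (Real.rpow_pos_of_pos (hK x hx).2.2.1 _)
  have hsc : ContinuousOn s R₀.toSet := continuousOn_pi.2 fun i =>
    ((continuous_apply i).comp_continuousOn hac).mul
      (hKc.rpow_const fun x hx => Or.inl (hK x hx).2.2.1.ne')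
  obtain ⟨A, hA⟩ := R₀.isCompact_toSet.exists_bound_of_continuousOn hsc
  have hA' : ∀ x ∈ R₀.toSet, ∀ i, s x i ≤ A := fun x hx i =>
    (le_abs_self _).trans ((norm_le_pi_norm (s x) i).trans (hA x hx))
  have hA0 : 0 ≤ A := (norm_nonneg _).trans (hA _ R₀.lo_mem)
  have hnorm : ∀ x ∈ R₀.toSet, (∏ i, s x i) ^ q *
      ‖pureErrLp I p (k + 1) fun i => pureCoeff (k + 1) f R₀.toSet x i * s x i ^ (k + 1)‖ ≤ 1 := by
    intro x hx
    obtain ⟨-, -, hK0, hKa, -⟩ := hK x hx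
    have h1 : (fun i => pureCoeff (k + 1) f R₀.toSet x i * s x i ^ (k + 1)) =
        K x ^ (-(σ⁻¹ / d) * (k + 1 : ℕ)) •
          fun i => pureCoeff (k + 1) f R₀.toSet x i * a x i ^ (k + 1) := by
      ext i
      rw [Pi.smul_apply, smul_eq_mul, Real.rpow_mul hK0.le, Real.rpow_natCast]
      simp only [hs, mul_pow]
      ring
    rw [h1, map_smul, norm_smul, hKa, Real.norm_of_nonneg (Real.rpow_nonneg hK0.le _), hprod x hx,
      ← Real.rpow_mul hK0.le]
    refine le_of_eq ?_
    nth_rewrite 3 [← Real.rpow_one (K x)]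
    rw [← Real.rpow_add hK0, ← Real.rpow_add hK0]
    have h2 : -σ⁻¹ * q + (-(σ⁻¹ / d) * (k + 1 : ℕ) + 1) = 0 := by
      have h3 : -σ⁻¹ * q + (-(σ⁻¹ / d) * (k + 1 : ℕ) + 1) = 1 - σ⁻¹ * σ := by
        rw [hσ]
        ring
      rw [h3, inv_mul_cancel₀ hσ0.ne', sub_self]
    rw [h2, Real.rpow_zero]
  set Jinf : ℝ≥0∞ :=
    ∫⁻ x in R₀.toSet, errorFun I p (taylorHom (k + 1) f R₀.toSet x) ^ σ⁻¹ with hJinf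
  have hpow : ∀ x ∈ R₀.toSet, errorFun I p (taylorHom (k + 1) f R₀.toSet x) ^ σ⁻¹ =
      ENNReal.ofReal (∏ i, s x i)⁻¹ := fun x hx => by
    obtain ⟨-, -, hK0, -, hKe⟩ := hK x hx
    rw [hKe, ENNReal.ofReal_rpow_of_pos hK0, hprod x hx, Real.rpow_neg hK0.le, inv_inv]
  have hJeq : ∫⁻ x in R₀.toSet, ENNReal.ofReal (∏ i, s x i)⁻¹ = Jinf :=
    (setLIntegral_congr_fun R₀.measurableSet_toSet hpow).symm
  have hJfin : Jinf ≠ ⊤ := by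
    obtain ⟨M, hM⟩ := R₀.isCompact_toSet.exists_bound_of_continuousOn hKc
    refine ne_top_of_le_ne_top (b := ∫⁻ _ in R₀.toSet, ENNReal.ofReal M ^ σ⁻¹) ?_ ?_
    · rw [setLIntegral_const]
      exact ENNReal.mul_ne_top (ENNReal.rpow_ne_top_of_nonneg (inv_pos.2 hσ0).le
        ENNReal.ofReal_ne_top) R₀.isCompact_toSet.measure_lt_top.ne
    · refine setLIntegral_mono' R₀.measurableSet_toSet fun x hx => ?_
      rw [(hK x hx).2.2.2.2]
      exact ENNReal.rpow_le_rpow (ENNReal.ofReal_le_ofReal ((le_abs_self _).trans (hM x hx)))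
        (inv_pos.2 hσ0).le
  set J : ℝ := Jinf.toReal with hJ
  have hJ0 : 0 ≤ J := ENNReal.toReal_nonneg
  have hJof : ENNReal.ofReal J = Jinf := ENNReal.ofReal_toReal hJfin
  have hrhs : eLpNorm (fun x => errorFun I p (taylorHom (k + 1) f R₀.toSet x)) (tau (k + 1) d p)
      (volume.restrict R₀.toSet) = ENNReal.ofReal ((J + 0) ^ σ * (1 + 0)) := by
    rw [eLpNorm_eq_lintegral_rpow_enorm_toReal hτ0.1.ne' hτ0.2.ne, hτ, one_div, inv_inv, add_zero,
      add_zero, mul_one, ← ENNReal.ofReal_rpow_of_nonneg hJ0 hσ0.le, hJof]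
    rfl
  rw [hrhs]
  refine exists_admissible R₀ (fun N P => (N : ℝ≥0∞) ^ (((k + 1 : ℕ) : ℝ) / (d : ℝ)) *
    eLpNorm (fun x => f x - interpPartition I P f x) p (volume.restrict R₀.toSet))
    (C := Real.sqrt d * A * (J + 1) ^ (1 / (d : ℝ))) (g := fun ε => (J + ε) ^ σ * (1 + ε)) ?_ ?_
  · refine Continuous.continuousWithinAt (Continuous.mul ?_ (by fun_prop))
    exact (continuous_const.add continuous_id).rpow_const fun _ => Or.inr hσ0.le
  · intro ε hε hε1
    filter_upwards [eventually_exists_partition hd hI hS p hf hsc hs0 hA' hnorm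
      (hJeq.trans hJof.symm).le hJ0 hA0 hε] with N ⟨P, hP, hcard, hdiam, herr⟩
    refine ⟨P, hP, hcard, fun R hR => (hdiam R hR).trans ?_, herr⟩
    gcongr
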